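/- Let $d$ be a positive integer that is not a square, let $K=\mathbb Q(\sqrt d)$ with ring of integers $\mathcal O_K$, and let $\mathcal O_{K,+}^\times$ be its group of totally positive units. Let $\varepsilon=\frac{a+b\sqrt d}{2}$ with $a,b\in\mathbb N$ be a generator of $\mathcal O_{K,+}^\times$, and put $\varepsilon'=\frac{a-b\sqrt d}{2}$. (Then $\varepsilon=a-1/\varepsilon$, so $\varepsilon$ has the minus continued fraction $[[a]]=a-\cfrac{1}{a-\cfrac{1}{a-\cdots}}$.) Let $\mathfrak f=(u+v\sqrt d)$, with $u,v\in\mathbb Z$, be a non-zero principal ideal of $\mathcal O_K$ of (absolute) norm $\mathcal N(\mathfrak f)$, and let $g=g(\mathfrak f)$ be the smallest positive integer such that $\varepsilon^{g}$ generates $\mathcal O_{K,+}^\times\cap(1+\mathfrak f)$. Write $[\,\cdot\,]$ for the fractional part in $[0,1)$, and $[\,\cdot\,]_1$ for the same except that $[m]_1=1$ for $m\in\mathbb Z$. Put $$x=\Big[-\frac{2v}{b\,\mathcal N(\mathfrak f)}\Big]_1,\qquad y=\Big[\frac{bu+av}{b\,\mathcal N(\mathfrak f)}\Big],$$ and let $(x_1,y_1)=(x,y)$,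 $(x_{l+1},y_{l+1})=([a x_l+y_l]_1,\,[-x_l])$ be the normalized orbit of $(x,y)$ under $(x,y)\mapsto(x,y)\begin{pmatrix}a&-1\\1&0\end{pmatrix}$. Assume that this orbit consists of $(x_1,y_1),\dots,(x_g,y_g)$, i.e. that $(x_{g+1},y_{g+1})=(x_1,y_1)$; this is automatic if $\mathcal O_K=\mathbb Z+\mathbb Z\varepsilon$. Define $$X_1(\mathfrak f)=\prod_{l=1}^{g}\mathcal S(\varepsilon,x_l\varepsilon+y_l),\qquad X_2(\mathfrak f)=\prod_{l=1}^{g}\mathcal S(\varepsilon',x_l\varepsilon'+y_l),$$ where $\mathcal S$ is the double sine function with periods $\omega,1$: for $\omega>0$ and $0<z<1+\omega$, $$\mathcal S(\omega,z)=\frac{\Gamma_2(1+\omega-z\mid\omega,1)}{\Gamma_2(z\mid\omega,1)}=\exp\int_0^\infty\Big(\frac{\sinh((2z-\omega-1)t)}{2\sinh(\omega t)\sinh(t)}-\frac{2z-\omega-1}{2\omega t}\Big)\frac{dt}{t}.$$ For coprime integers $m,n$ with $n>1$, the cyclic quantum dilogarithm is $$D_{m/n}(x,y)=\prod_{k=1}^{n-1}\big(1-e^{2\pi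 i(k\frac mn+x\frac mn+y)}\big)^{k/n}.$$ Let $T_n$ be the polynomial characterized by $T_n(z+z^{-1})=z^n+z^{-n}$, and let $\mathfrak t_n=T_{n-1}(a)/T_n(a)$. Then $$X_1(\mathfrak f)=\lim_{n\to\infty}\left|\frac{D_{\mathfrak t_n}(y,x)}{D_{\mathfrak t_{n+g}}(y,x)}\right|,\qquad X_2(\mathfrak f)=\lim_{n\to\infty}\left|\frac{D_{\mathfrak t_n}(x,y)}{D_{\mathfrak t_{n+g}}(x,y)}\right|,$$ where each limit is taken over those $n$ for which the denominator is non-zero (nothing is asserted about a limit for which there are only finitely many such $n$). -/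

import Mathlib

open Filter Topology NumberField

noncomputable section

namespace Shintani

/-- The group `𝓞_{K,+}ˣ` of totally positive units of a number field `K`. -/
def totallyPositiveUnits (K : Type*) [Field K] : Subgroup (𝓞 K)ˣ where
  carrier := {e | ∀ σ : K →+* ℝ, 0 < σ ((e : 𝓞 K) : K)}
  one_mem' := by intro σ; simp
  mul_mem' := by
    intro e e' he he' σ
    simpa using mul_pos (he σ) (he' σ)
  inv_mem' := by
    intro e he σ
    have h : σ ((e : 𝓞 K) : K) * σ (((e⁻¹ : (𝓞 K)ˣ) : 𝓞 K) : K) = 1 := by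
      rw [← map_mul, ← map_mul, Units.mul_inv, map_one, map_one]
    exact pos_of_mul_pos_right (h ▸ one_pos) (he σ).le

/-- `g(𝔣)`: the smallest positive integer `g` such that `ε ^ g` generates
`𝓞_{K,+}ˣ ∩ (1 + 𝔣)`. -/
def conductorExponent {K : Type*} [Field K] (ε : (𝓞 K)ˣ) (𝔣 : Ideal (𝓞 K)) : ℕ :=
  sInf {g : ℕ | 0 < g ∧ (Subgroup.zpowers (ε ^ g) : Set (𝓞 K)ˣ) =
    {e | e ∈ totallyPositiveUnits K ∧ (e : 𝓞 K) - 1 ∈ 𝔣}}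

/-- The representative in `(0, 1]` of the class of `q` modulo `ℤ`, i.e. the fractional part
with `[0]₁ = 1`. -/
def fractOne (q : ℚ) : ℚ := if Int.fract q = 0 then 1 else Int.fract q

/-- The pair `(x, y)` attached to the principal ideal generated by `u + v √d`, of absolute
norm `N`. -/
def shintaniPair (a b : ℕ) (u v : ℤ) (N : ℕ) : ℚ × ℚ :=
  (fractOne (-(2 * (v : ℚ)) / ((b : ℚ) * (N : ℚ))),
    Int.fract (((b : ℚ) * (u : ℚ) + (a : ℚ) * (v : ℚ)) / ((b : ℚ) * (N : ℚ))))

/-- The matrix `U`. -/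
def shintaniMatrix (a : ℕ) : Matrix (Fin 2) (Fin 2) ℚ := !![(a : ℚ), -1; 1, 0]

/-- One step `(x, y) ↦ (x, y) U` of the normalized orbit. Since `ε² = a ε - 1`, this is
multiplication of `x ε + y` by `ε`, followed by reduction of the coordinates modulo `ℤ` to
`(0, 1] × [0, 1)`. -/
def orbitStep (a : ℕ) (p : ℚ × ℚ) : ℚ × ℚ :=
  (fractOne (Matrix.vecMul ![p.1, p.2] (shintaniMatrix a) 0),
    Int.fract (Matrix.vecMul ![p.1, p.2] (shintaniMatrix a) 1))

/-- The double sine function `𝒮(ω, z)` with periods `(ω, 1)`, for `ω > 0` and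
`0 < z < 1 + ω`, given by its integral representation. In terms of Barnes' double gamma
function it is `Γ₂(1 + ω - z | ω, 1) / Γ₂(z | ω, 1)`; thus
`𝒮(ω, z + 1) = 𝒮(ω, z) / (2 sin (π z / ω))` and `𝒮(ω, (1 + ω) / 2) = 1`. -/
def doubleSine (ω z : ℝ) : ℝ :=
  Real.exp (∫ t in Set.Ioi (0 : ℝ),
    (Real.sinh ((2 * z - ω - 1) * t) / (2 * Real.sinh (ω * t) * Real.sinh t)
      - (2 * z - ω - 1) / (2 * ω * t)) / t)

/-- The product of `𝒮(ω, x_l ω + y_l)` over the first `g` members `(x_l, y_l)` of the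
normalized orbit of `p`. -/
def shintaniProduct (a g : ℕ) (p : ℚ × ℚ) (ω : ℝ) : ℝ :=
  ∏ l ∈ Finset.range g,
    doubleSine ω ((((orbitStep a)^[l] p).1 : ℝ) * ω + (((orbitStep a)^[l] p).2 : ℝ))

/-- `T_n(a)`, where `T_n (x + x⁻¹) = x ^ n + x ^ (-n)`. -/
def chebyshevT (a : ℕ) (n : ℤ) : ℤ := (Polynomial.Chebyshev.C ℤ n).eval (a : ℤ)

/-- `𝔱_n = T_{n-1}(a) / T_n(a)`. -/
def cuspSeq (a n : ℕ) : ℚ := (chebyshevT a ((n : ℤ) - 1) : ℚ) / (chebyshevT a (n : ℤ) : ℚ)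

/-- The cyclic quantum dilogarithm `D_{m/n}(x, y)`, where `m / n` is the rational number `t` in
lowest terms. -/
def cyclicDilog (t x y : ℚ) : ℂ :=
  ∏ k ∈ Finset.Icc 1 (t.den - 1),
    (1 - Complex.exp (2 * Real.pi * Complex.I * ((k : ℂ) * (t : ℂ) + (x : ℂ) * (t : ℂ) + (y : ℂ))))
      ^ ((k : ℂ) / (t.den : ℂ))

end Shintani

end

/-! Put ω = ε' = 1/ε, so that ω(a − ω) = 1 and 0 < ω < 1. The cusps 𝔱_r are iterates of t ↦ 1/(a −
t) and converge to its fixed point ω.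

At a rational period m/n the double sine function is elementary. Once the periods are rescaled to
1/n and 1/m, its logarithm is a sum over an n × m grid of values with both periods equal to 1. There
log 𝒮 at w is (1 − w) log|2 sin πw| plus a function of period one, and distribution relations
collapse the double sum. The linear weights i/n and j/m leave two sums ∑ (k/N) log|2 sin π(z + kt)|,
with N the denominator of t, that is, two values of log|D_t|. One has t = m/n; the other, after
reflection, has t = a − n/m (`logSineIntegral_rat`, `logSineIntegral_reciprocity`).

For m/n = 𝔱_{r+1} the second slope is 𝔱_r. The leftover term is O(1/m), so continuity in the period
exhibits log 𝒮(ω, pω + q) as the limit of log|D_{𝔱_r}(p', q')| − log|D_{𝔱_{r+1}}(p, q)|, where p' =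
1 − q and q' ≡ aq + p mod 1 (`tendsto_norm_cyclicDilog_div`). Along a chain of such pairs the
quotients telescope (`tendsto_norm_cyclicDilog_chain`). The pairs (y_l, x_l), in the order of the
orbit, form a chain and give X_1, since 𝒮(ε, xε + y) = 𝒮(ω, yω + x); the pairs (x_l, y_l) in reverse
order form a chain and give X_2.

Reciprocity requires nz ∉ ℤ. Far along the sequence, failure of this makes D vanish, except for the
pair (0, 1), which is settled by |D_t(0, 1)|² = den t and 𝒮(ω, 1)² = ω. -/

noncomputable section

namespace Shintani

open MeasureTheory

/-! ### Symmetries of the logarithm of the double sine function -/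

/-- The integrand of the homogeneous form of the logarithm of the double sine function. -/
def sineKernel (α β c s : ℝ) : ℝ :=
  (Real.sinh (c * s) / (2 * Real.sinh (α * s) * Real.sinh (β * s)) - c / (2 * α * β * s)) / s

/-- The logarithm of the double sine function with periods `α, β` at `z`, where
`c = 2 * z - α - β`. -/
def logSineIntegral (α β c : ℝ) : ℝ := ∫ s in Set.Ioi (0 : ℝ), sineKernel α β c s

theorem doubleSine_eq_exp (ω z : ℝ) :
    doubleSine ω z = Real.exp (logSineIntegral ω 1 (2 * z - ω - 1)) := by
  simp [doubleSine, logSineIntegral, sineKernel]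

theorem sineKernel_scale {lam : ℝ} (hl : lam ≠ 0) (α β c s : ℝ) :
    sineKernel (lam * α) (lam * β) (lam * c) s = lam * sineKernel α β c (lam * s) := by
  unfold sineKernel
  rcases eq_or_ne s 0 with rfl | hs
  · simp
  have h1 : lam * c / (2 * (lam * α) * (lam * β) * s) = c / (2 * α * β * (lam * s)) := by
    rw [show 2 * (lam * α) * (lam * β) * s = lam * (2 * α * β * (lam * s)) by ring,
      mul_div_mul_left _ _ hl]
  rw [h1, show lam * c * s = c * (lam * s) by ring, show lam * α * s = α * (lam * s) by ring,
    show lam * β * s = β * (lam * s) by ring]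
  generalize Real.sinh (c * (lam * s)) / _ - _ = r
  field_simp

/-- Substitution s ↦ lam · s. This homogeneity is why both periods are kept as parameters: it
exchanges ω for 1/ω and clears the denominator of a rational period. -/
theorem logSineIntegral_scale {lam : ℝ} (hl : 0 < lam) (α β c : ℝ) :
    logSineIntegral (lam * α) (lam * β) (lam * c) = logSineIntegral α β c := by
  unfold logSineIntegral
  simp_rw [sineKernel_scale hl.ne']
  rw [integral_const_mul, integral_comp_mul_left_Ioi (fun s => sineKernel α β c s) 0 hl]
  simp only [mul_zero, smul_eq_mul]
  rw [← mul_assoc, mul_inv_cancel₀ hl.ne', one_mul]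

theorem sineKernel_swap (α β c s : ℝ) : sineKernel α β c s = sineKernel β α c s := by
  unfold sineKernel
  rw [mul_right_comm 2, mul_right_comm 2 α]

theorem sineKernel_neg (α β c s : ℝ) : sineKernel α β (-c) s = -sineKernel α β c s := by
  unfold sineKernel
  rw [neg_mul, Real.sinh_neg]
  ring

/-! ### Convergence of the integral and continuity in the parameters -/

theorem sinh_le_mul_cosh {x : ℝ} (hx : 0 ≤ x) : Real.sinh x ≤ x * Real.cosh x := by
  have hd : ∀ y : ℝ, HasDerivAt (fun y => y * Real.cosh y - Real.sinh y) (y * Real.sinh y) y := by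
    intro y
    have h : HasDerivAt (fun y => y * Real.cosh y - Real.sinh y)
        (1 * Real.cosh y + y * Real.sinh y - Real.cosh y) y :=
      ((hasDerivAt_id y).mul (Real.hasDerivAt_cosh y)).sub (Real.hasDerivAt_sinh y)
    rwa [one_mul, add_sub_cancel_left] at h
  have hmono : MonotoneOn (fun y => y * Real.cosh y - Real.sinh y) (Set.Ici 0) := by
    apply monotoneOn_of_deriv_nonneg (convex_Ici 0)
    · exact fun y _ => (hd y).continuousAt.continuousWithinAt
    · exact fun y _ => (hd y).differentiableAt.differentiableWithinAt
    · intro y hy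
      rw [interior_Ici] at hy
      rw [(hd y).deriv]
      exact mul_nonneg (le_of_lt hy) (Real.sinh_nonneg_iff.2 (le_of_lt hy))
  have := hmono (Set.mem_Ici.2 le_rfl) hx hx
  simp at this
  linarith

/-- Combines sinh x ≤ x cosh x and cosh x ≤ exp(x²/2) with e^t − 1 ≤ t e^t at t = x²/2. -/
theorem sinh_sub_self_le {x : ℝ} (hx : 0 ≤ x) :
    Real.sinh x - x ≤ x ^ 3 * Real.exp (x ^ 2 / 2) := by
  have h1 := sinh_le_mul_cosh hx
  have h2 := Real.cosh_le_exp_half_sq x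
  have h3 : Real.exp (x ^ 2 / 2) - 1 ≤ x ^ 2 / 2 * Real.exp (x ^ 2 / 2) := by
    have h4 := Real.add_one_le_exp (-(x ^ 2 / 2))
    have h5 : Real.exp (-(x ^ 2 / 2)) * Real.exp (x ^ 2 / 2) = 1 := by
      rw [← Real.exp_add]; simp
    nlinarith [Real.exp_pos (x ^ 2 / 2)]
  have h6 : x * Real.cosh x ≤ x * Real.exp (x ^ 2 / 2) := by gcongr
  have h7 : x * (Real.exp (x ^ 2 / 2) - 1) ≤ x * (x ^ 2 / 2 * Real.exp (x ^ 2 / 2)) := by gcongr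
  have h8 : 0 ≤ x ^ 3 * Real.exp (x ^ 2 / 2) := by positivity
  nlinarith

theorem abs_sinh_sub_self_le {x X : ℝ} (hx : |x| ≤ X) :
    |Real.sinh x - x| ≤ |x| ^ 3 * Real.exp (X ^ 2 / 2) := by
  have key : ∀ y : ℝ, 0 ≤ y → y ≤ X → |Real.sinh y - y| ≤ y ^ 3 * Real.exp (X ^ 2 / 2) := by
    intro y hy hyX
    rw [abs_of_nonneg (sub_nonneg.2 (Real.self_le_sinh_iff.2 hy))]
    refine (sinh_sub_self_le hy).trans ?_
    gcongr
  rcases le_total 0 x with h | h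
  · rw [abs_of_nonneg h] at hx ⊢
    exact key x h hx
  · rw [abs_of_nonpos h] at hx ⊢
    have := key (-x) (by linarith) hx
    rwa [Real.sinh_neg, ← neg_sub', abs_neg] at this

/-- Bound for the integrand near zero. -/
theorem abs_sineKernel_le_of_le_one {α₀ W : ℝ} (h0 : 0 < α₀) :
    ∃ M : ℝ, 0 ≤ M ∧ ∀ α β c s : ℝ, α₀ ≤ α → α ≤ W → α₀ ≤ β → β ≤ W → |c| ≤ 2 * W →
      0 < s → s ≤ 1 → |sineKernel α β c s| ≤ M := by
  obtain ⟨E, hE, hE0⟩ : ∃ E, E = Real.exp ((2 * |W|) ^ 2 / 2) ∧ 0 < E := ⟨_, rfl, Real.exp_pos _⟩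
  set V := 2 * |W| with hV
  have hV0 : 0 ≤ V := by positivity
  -- V bounds α, β and |c|, and V³E bounds |sinh(γs) − γs| / s³ for |γ| ≤ V. The numerator is the
  -- constant of `hnum`, the denominator that of `hden`.
  refine ⟨(V * V * (V ^ 3 * E) + V * ((V + V ^ 3 * E) * (V ^ 3 * E) + V * (V ^ 3 * E))) /
    (2 * α₀ ^ 4), by positivity, ?_⟩
  intro α β c s hα hαW hβ hβW hc hs hs1
  have hα0 : 0 < α := h0.trans_le hα
  have hβ0 : 0 < β := h0.trans_le hβ
  have hWV : W ≤ V := by rw [hV]; linarith [le_abs_self W, abs_nonneg W]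
  have hαV : α ≤ V := hαW.trans hWV
  have hβV : β ≤ V := hβW.trans hWV
  have hcV : |c| ≤ V := hc.trans (by rw [hV]; linarith [le_abs_self W])
  have sinh_bd : ∀ γ : ℝ, |γ| ≤ V → |Real.sinh (γ * s) - γ * s| ≤ V ^ 3 * E * s ^ 3 := by
    intro γ hγ
    have h1 : |γ * s| ≤ V := by
      rw [abs_mul, abs_of_pos hs]
      nlinarith [abs_nonneg γ]
    refine (abs_sinh_sub_self_le h1).trans ?_
    rw [abs_mul, abs_of_pos hs, mul_pow, hE, mul_right_comm]
    gcongr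
  have hA := sinh_bd α (by rwa [abs_of_pos hα0])
  have hB := sinh_bd β (by rwa [abs_of_pos hβ0])
  have hN := sinh_bd c hcV
  have hA1 : α * s ≤ Real.sinh (α * s) := Real.self_le_sinh_iff.2 (by positivity)
  have hB1 : β * s ≤ Real.sinh (β * s) := Real.self_le_sinh_iff.2 (by positivity)
  unfold sineKernel
  generalize Real.sinh (α * s) = A at *
  generalize Real.sinh (β * s) = B at *
  generalize Real.sinh (c * s) = N at *
  set D := V ^ 3 * E with hD
  have hD0 : 0 ≤ D := by positivity
  have hA0 : 0 < A := lt_of_lt_of_le (by positivity) hA1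
  have hB0 : 0 < B := lt_of_lt_of_le (by positivity) hB1
  -- Over a common denominator of order s⁴ the leading terms cancel: every remaining term of the
  -- numerator has a factor sinh(γs) − γs = O(s³) and a further factor O(s).
  have e : (N / (2 * A * B) - c / (2 * α * β * s)) / s =
      (α * β * s * (N - c * s) - c * (A * (B - β * s) + β * s * (A - α * s))) /
        (2 * α * β * s ^ 2 * (A * B)) := by
    field_simp
    ring
  rw [e, abs_div, abs_of_pos (a := 2 * α * β * s ^ 2 * (A * B)) (by positivity)]
  have hs3 : s ^ 3 ≤ s := by nlinarith [sq_nonneg s, mul_pos hs hs]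
  have hAs : A ≤ (V + D) * s := by
    have := (abs_le.1 hA).2
    nlinarith [mul_le_mul_of_nonneg_right hαV hs.le, mul_le_mul_of_nonneg_left hs3 hD0]
  have hnum : |α * β * s * (N - c * s) - c * (A * (B - β * s) + β * s * (A - α * s))| ≤
      (V * V * D + V * ((V + D) * D + V * D)) * s ^ 4 := by
    have t1 : |α * β * s * (N - c * s)| ≤ V * V * s * (D * s ^ 3) := by
      rw [abs_mul, abs_of_pos (a := α * β * s) (by positivity)]
      gcongr
    have t2 : |A * (B - β * s)| ≤ (V + D) * s * (D * s ^ 3) := by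
      rw [abs_mul, abs_of_pos hA0]
      gcongr
    have t3 : |β * s * (A - α * s)| ≤ V * s * (D * s ^ 3) := by
      rw [abs_mul, abs_of_pos (a := β * s) (by positivity)]
      gcongr
    have t4 : |c * (A * (B - β * s) + β * s * (A - α * s))| ≤
        V * ((V + D) * s * (D * s ^ 3) + V * s * (D * s ^ 3)) := by
      rw [abs_mul]
      gcongr
      exact (abs_add_le _ _).trans (add_le_add t2 t3)
    calc _ ≤ _ := abs_sub _ _
      _ ≤ V * V * s * (D * s ^ 3) + V * ((V + D) * s * (D * s ^ 3) + V * s * (D * s ^ 3)) :=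
        add_le_add t1 t4
      _ = _ := by ring
  have hden : 2 * α₀ ^ 4 * s ^ 4 ≤ 2 * α * β * s ^ 2 * (A * B) := by
    calc 2 * α₀ ^ 4 * s ^ 4 = 2 * α₀ * α₀ * s ^ 2 * ((α₀ * s) * (α₀ * s)) := by ring
      _ ≤ 2 * α * β * s ^ 2 * ((α * s) * (β * s)) := by gcongr
      _ ≤ _ := by gcongr
  calc _ ≤ ((V * V * D + V * ((V + D) * D + V * D)) * s ^ 4) / (2 * α₀ ^ 4 * s ^ 4) := by
        gcongr
    _ = _ := by field_simp

/-- The hyperbolic quotient decays like exp((|c| − α − β)s); the subtracted term contributes s⁻². -/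
theorem abs_sineKernel_le_of_one_le {α₀ W δ : ℝ} (h0 : 0 < α₀) :
    ∃ M₁ M₂ : ℝ, 0 ≤ M₁ ∧ 0 ≤ M₂ ∧ ∀ α β c s : ℝ, α₀ ≤ α → α₀ ≤ β → |c| ≤ 2 * W →
      |c| ≤ α + β - δ → 1 ≤ s →
      |sineKernel α β c s| ≤ M₁ * Real.exp (-δ * s) + M₂ * s ^ (-2 : ℝ) := by
  -- Since sinh x = e^x (1 − e^{−2x})/2, this κ satisfies sinh x ≥ κ e^x for all x ≥ α₀.
  set κ := (1 - Real.exp (-2 * α₀)) / 2 with hκ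
  have hκ0 : 0 < κ := by
    have : Real.exp (-2 * α₀) < 1 := by rw [Real.exp_lt_one_iff]; linarith
    rw [hκ]; linarith
  refine ⟨1 / (2 * κ ^ 2), |W| / α₀ ^ 2, by positivity, by positivity, ?_⟩
  intro α β c s hα hβ hc hcd hs
  have hs0 : 0 < s := by linarith
  have hα0 : 0 < α := h0.trans_le hα
  have hβ0 : 0 < β := h0.trans_le hβ
  have sinh_low : ∀ γ : ℝ, α₀ ≤ γ → κ * Real.exp (γ * s) ≤ Real.sinh (γ * s) := by
    intro γ hγ
    rw [Real.sinh_eq, hκ]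
    have h1 : Real.exp (-(γ * s)) = Real.exp (-2 * (γ * s)) * Real.exp (γ * s) := by
      rw [← Real.exp_add]; congr 1; ring
    have h2 : Real.exp (-2 * (γ * s)) ≤ Real.exp (-2 * α₀) := by
      apply Real.exp_le_exp.2; nlinarith
    rw [h1]
    nlinarith [Real.exp_pos (γ * s)]
  have hA := sinh_low α hα
  have hB := sinh_low β hβ
  have hN : |Real.sinh (c * s)| ≤ Real.exp (|c| * s) := by
    rw [Real.abs_sinh, abs_mul, abs_of_pos hs0, Real.sinh_eq]
    have h1 := Real.exp_pos (|c| * s)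
    have h2 := Real.exp_pos (-(|c| * s))
    linarith
  have t1 : |Real.sinh (c * s) / (2 * Real.sinh (α * s) * Real.sinh (β * s))| ≤
      1 / (2 * κ ^ 2) * Real.exp (-δ * s) := by
    have hA0 : 0 < κ * Real.exp (α * s) := by positivity
    have hB0 : 0 < κ * Real.exp (β * s) := by positivity
    rw [abs_div, abs_of_pos (a := 2 * Real.sinh (α * s) * Real.sinh (β * s))
      (by have := hA0.trans_le hA; have := hB0.trans_le hB; positivity)]
    calc _ ≤ Real.exp (|c| * s) / (2 * (κ * Real.exp (α * s)) * (κ * Real.exp (β * s))) := by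
          gcongr
      _ = 1 / (2 * κ ^ 2) * Real.exp (|c| * s - α * s - β * s) := by
          rw [Real.exp_sub, Real.exp_sub]; field_simp
      _ ≤ _ := by
          gcongr
          nlinarith
  have t2 : |c / (2 * α * β * s) / s| ≤ |W| / α₀ ^ 2 * s ^ (-2 : ℝ) := by
    rw [abs_div, abs_div, abs_of_pos hs0, abs_of_pos (a := 2 * α * β * s) (by positivity),
      Real.rpow_neg hs0.le, Real.rpow_two]
    calc _ ≤ 2 * |W| / (2 * α₀ * α₀ * s) / s := by
          gcongr
          exact hc.trans (by linarith [le_abs_self W])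
      _ = _ := by field_simp
  unfold sineKernel
  rw [sub_div]
  refine (abs_sub _ _).trans (add_le_add ?_ t2)
  rw [abs_div, abs_of_pos hs0]
  exact (div_le_self (abs_nonneg _) hs).trans t1

/-- A dominating function for the integrands, locally uniform in the parameters. -/
theorem exists_sineKernel_bound {α₀ W δ : ℝ} (h0 : 0 < α₀) (hδ : 0 < δ) :
    ∃ F : ℝ → ℝ, IntegrableOn F (Set.Ioi 0) ∧ ∀ α β c s : ℝ, α₀ ≤ α → α ≤ W → α₀ ≤ β → β ≤ W →
      |c| ≤ α + β - δ → 0 < s → ‖sineKernel α β c s‖ ≤ F s := by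
  obtain ⟨M, hM, hb⟩ := abs_sineKernel_le_of_le_one (W := W) h0
  obtain ⟨M₁, M₂, hM₁, hM₂, hb'⟩ := abs_sineKernel_le_of_one_le (W := W) (δ := δ) h0
  refine ⟨fun s => (Set.Ioc 0 1).indicator (fun _ => M) s +
    (M₁ * Real.exp (-δ * s) + (Set.Ioi 1).indicator (fun s => M₂ * s ^ (-2 : ℝ)) s), ?_, ?_⟩
  · refine Integrable.add ?_ (Integrable.add ?_ ?_)
    · refine IntegrableOn.integrable_indicator ?_ measurableSet_Ioc
      refine IntegrableOn.mono_measure ?_ Measure.restrict_le_self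
      simp
    · exact (integrableOn_exp_mul_Ioi (by linarith) 0).const_mul _
    · refine IntegrableOn.integrable_indicator ?_ measurableSet_Ioi
      refine IntegrableOn.mono_measure ?_ Measure.restrict_le_self
      exact (integrableOn_Ioi_rpow_of_lt (by norm_num) one_pos).const_mul _
  · intro α β c s hα hαW hβ hβW hc hs
    have hcW : |c| ≤ 2 * W := by linarith
    rw [Real.norm_eq_abs]
    beta_reduce
    rcases le_or_gt s 1 with h | h
    · rw [Set.indicator_of_mem (show s ∈ Set.Ioc (0 : ℝ) 1 from ⟨hs, h⟩),
        Set.indicator_of_notMem (show s ∉ Set.Ioi (1 : ℝ) from not_lt.2 h)]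
      have := hb α β c s hα hαW hβ hβW hcW hs h
      have : 0 ≤ M₁ * Real.exp (-δ * s) := by positivity
      linarith
    · rw [Set.indicator_of_notMem (show s ∉ Set.Ioc (0 : ℝ) 1 from fun h' => not_lt.2 h'.2 h),
        Set.indicator_of_mem (show s ∈ Set.Ioi (1 : ℝ) from h), zero_add]
      exact hb' α β c s hα hβ hcW hc h.le

theorem measurable_sineKernel (α β c : ℝ) : Measurable (sineKernel α β c) := by
  unfold sineKernel
  fun_prop

theorem integrableOn_sineKernel {α β c : ℝ} (hα : 0 < α) (hβ : 0 < β) (hc : |c| < α + β) :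
    IntegrableOn (sineKernel α β c) (Set.Ioi 0) := by
  obtain ⟨F, hF, hb⟩ := exists_sineKernel_bound (α₀ := min α β) (W := max α β)
    (δ := α + β - |c|) (lt_min hα hβ) (by linarith)
  refine Integrable.mono' hF (measurable_sineKernel α β c).aestronglyMeasurable ?_
  refine (ae_restrict_iff' measurableSet_Ioi).2 (ae_of_all _ fun s hs => ?_)
  exact hb α β c s (min_le_left _ _) (le_max_left _ _) (min_le_right _ _) (le_max_right _ _)
    (by linarith) hs

theorem continuousAt_logSineIntegral {ω c : ℝ} (hω : 0 < ω) (hc : |c| < ω + 1) :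
    ContinuousAt (fun p : ℝ × ℝ => logSineIntegral p.1 1 p.2) (ω, c) := by
  -- Half of the available gap, so that |c'| < ω' + 1 − δ persists for all (ω', c') near (ω, c) and
  -- one dominating function serves a whole neighbourhood.
  set δ := (ω + 1 - |c|) / 2 with hδ
  have hδ0 : 0 < δ := by rw [hδ]; linarith
  obtain ⟨F, hF, hb⟩ := exists_sineKernel_bound (α₀ := min (ω / 2) 1) (W := max (ω + 1) 1)
    (lt_min (by linarith) one_pos) hδ0
  unfold logSineIntegral
  have hev : ∀ᶠ p : ℝ × ℝ in 𝓝 (ω, c), ω / 2 < p.1 ∧ p.1 < ω + 1 ∧ |p.2| < p.1 + 1 - δ := by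
    refine (ContinuousAt.eventually_lt (by fun_prop) (by fun_prop) (by simp; linarith)).and
      ((ContinuousAt.eventually_lt (by fun_prop) (by fun_prop) (by simp)).and
      (ContinuousAt.eventually_lt (by fun_prop) (by fun_prop) (by simp; linarith)))
  refine continuousAt_of_dominated (bound := F) ?_ ?_ hF ?_
  · exact Eventually.of_forall fun p => (measurable_sineKernel _ _ _).aestronglyMeasurable
  · filter_upwards [hev] with p hp
    refine (ae_restrict_iff' measurableSet_Ioi).2 (ae_of_all _ fun s hs => ?_)
    exact hb p.1 1 p.2 s ((min_le_left _ _).trans hp.1.le) (hp.2.1.le.trans (le_max_left _ _))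
      (min_le_right _ _) (le_max_right _ _) hp.2.2.le hs
  · refine (ae_restrict_iff' measurableSet_Ioi).2 (ae_of_all _ fun s hs => ?_)
    have hs : 0 < s := hs
    have h1 : Real.sinh (ω * s) ≠ 0 := (Real.sinh_pos_iff.2 (by positivity)).ne'
    have h2 : Real.sinh (1 * s) ≠ 0 := (Real.sinh_pos_iff.2 (by positivity)).ne'
    unfold sineKernel
    refine ContinuousAt.div (ContinuousAt.sub (ContinuousAt.div ?_ ?_ ?_)
      (ContinuousAt.div ?_ ?_ ?_)) ?_ hs.ne'
    any_goals fun_prop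
    · exact mul_ne_zero (mul_ne_zero two_ne_zero h1) h2
    · exact mul_ne_zero (mul_ne_zero (mul_ne_zero two_ne_zero hω.ne') one_ne_zero) hs.ne'

/-! ### Functional equations of the double sine function -/

/-- The function `log |2 sin (π x)|`. -/
def logTwoSin (x : ℝ) : ℝ := Real.log |2 * Real.sin (Real.pi * x)|

theorem logTwoSin_add_one (x : ℝ) : logTwoSin (x + 1) = logTwoSin x := by
  simp [logTwoSin, mul_add, Real.sin_add_pi]

theorem periodic_logTwoSin : Function.Periodic logTwoSin 1 := logTwoSin_add_one

/-- The integrand of the integral representation of `-log (2 sin (π z))`. -/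
def shiftKernel (z s : ℝ) : ℝ :=
  (Real.cosh ((2 * z - 1) * s) / Real.sinh s - 1 / s) / s

/-- The addition formula produces a factor sinh(ωs) that cancels the one in the denominator. The
difference therefore no longer depends on ω. -/
theorem sineKernel_sub_sineKernel {ω s : ℝ} (hω : 0 < ω) (hs : 0 < s) (z : ℝ) :
    sineKernel ω 1 (2 * z + ω - 1) s - sineKernel ω 1 (2 * z - ω - 1) s = shiftKernel z s := by
  unfold sineKernel shiftKernel
  have h1 : 0 < Real.sinh (ω * s) := Real.sinh_pos_iff.2 (by positivity)
  have h2 : 0 < Real.sinh s := Real.sinh_pos_iff.2 hs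
  have e : Real.sinh ((2 * z + ω - 1) * s) - Real.sinh ((2 * z - ω - 1) * s) =
      2 * Real.cosh ((2 * z - 1) * s) * Real.sinh (ω * s) := by
    rw [show (2 * z + ω - 1) * s = (2 * z - 1) * s + ω * s by ring,
      show (2 * z - ω - 1) * s = (2 * z - 1) * s - ω * s by ring, Real.sinh_add, Real.sinh_sub]
    ring
  rw [eq_add_of_sub_eq e, one_mul]
  field_simp
  ring

theorem integrableOn_shiftKernel {z : ℝ} (h0 : 0 < z) (h1 : z < 1) :
    IntegrableOn (shiftKernel z) (Set.Ioi 0) := by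
  have h : IntegrableOn (fun s => sineKernel 1 1 (2 * z + 1 - 1) s -
      sineKernel 1 1 (2 * z - 1 - 1) s) (Set.Ioi 0) :=
    (integrableOn_sineKernel one_pos one_pos (by rw [abs_lt]; constructor <;> linarith)).sub
    (integrableOn_sineKernel one_pos one_pos (by rw [abs_lt]; constructor <;> linarith))
  refine h.congr_fun (fun s hs => ?_) measurableSet_Ioi
  exact sineKernel_sub_sineKernel one_pos hs z

theorem logSineIntegral_sub_eq_integral {ω z : ℝ} (hω : 0 < ω) (h0 : 0 < z) (h1 : z < 1) :
    logSineIntegral ω 1 (2 * z + ω - 1) - logSineIntegral ω 1 (2 * z - ω - 1) =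
      ∫ s in Set.Ioi 0, shiftKernel z s := by
  unfold logSineIntegral
  rw [← integral_sub
    (integrableOn_sineKernel hω one_pos (by rw [abs_lt]; constructor <;> linarith))
    (integrableOn_sineKernel hω one_pos (by rw [abs_lt]; constructor <;> linarith))]
  exact setIntegral_congr_fun measurableSet_Ioi fun s hs => sineKernel_sub_sineKernel hω hs z

theorem integrableOn_exp_sub_exp_div {a b : ℝ} (ha : 0 < a) (hb : 0 < b) :
    IntegrableOn (fun s => (Real.exp (-(a * s)) - Real.exp (-(b * s))) / s) (Set.Ioi 0) := by
  wlog hab : a ≤ b generalizing a b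
  · have := (this hb ha (le_of_not_ge hab)).neg
    refine this.congr_fun (fun s _ => ?_) measurableSet_Ioi
    simp only [Pi.neg_apply]
    ring
  refine Integrable.mono' (((integrableOn_exp_mul_Ioi (neg_lt_zero.2 ha) 0).const_mul (b - a)))
    (Measurable.aestronglyMeasurable (by fun_prop)) ?_
  refine (ae_restrict_iff' measurableSet_Ioi).2 (ae_of_all _ fun s hs => ?_)
  have hs : 0 < s := hs
  have h1 : Real.exp (-(b * s)) = Real.exp (-(a * s)) * Real.exp (-((b - a) * s)) := by
    rw [← Real.exp_add]; congr 1; ring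
  have h2 := Real.add_one_le_exp (-((b - a) * s))
  have h3 : Real.exp (-((b - a) * s)) ≤ 1 := by
    rw [Real.exp_le_one_iff]; nlinarith
  rw [h1, ← mul_one_sub, Real.norm_eq_abs,
    abs_of_nonneg (div_nonneg (mul_nonneg (Real.exp_pos _).le (by linarith)) hs.le),
    div_le_iff₀ hs, neg_mul]
  nlinarith [Real.exp_pos (-(a * s))]

theorem integral_exp_sub_exp_div {a b : ℝ} (ha : 0 < a) (hb : 0 < b) :
    ∫ s in Set.Ioi 0, (Real.exp (-(a * s)) - Real.exp (-(b * s))) / s = Real.log (b / a) := by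
  have h := Frullani.integral_Ioi_eq (f := fun x : ℝ => Real.exp (-x)) (L := 1) (R := 0)
    (ContinuousOn.locallyIntegrableOn (by fun_prop) measurableSet_Ioi) ha hb
    (by
      refine Tendsto.mono_left ?_ nhdsWithin_le_nhds
      have : ContinuousAt (fun x : ℝ => Real.exp (-x)) 0 := by fun_prop
      simpa [ContinuousAt] using this)
    (Real.tendsto_exp_neg_atTop_nhds_zero)
    (by
      refine (integrableOn_exp_sub_exp_div ha hb).congr_fun (fun s _ => ?_) measurableSet_Ioi
      simp only [smul_eq_mul]
      ring)
  simp only [smul_eq_mul, sub_zero, mul_one] at h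
  rw [← h]
  exact setIntegral_congr_fun measurableSet_Ioi fun s _ => div_eq_inv_mul _ _

/-- In the difference the terms 1/s cancel, and cosh((2z − 1)s)/sinh s is a numerator divided by 1 −
e^{−2s}. The extra factor 1 − e^{−2ns} turns this into a finite geometric sum, whose terms are
Frullani integrands. -/
theorem shiftKernel_sub_mul {z w s : ℝ} (hs : 0 < s) (n : ℕ) :
    (shiftKernel z s - shiftKernel w s) * (1 - Real.exp (-2 * s) ^ n) =
      ∑ k ∈ Finset.range n,
        ((Real.exp (-((2 * (k + z)) * s)) - Real.exp (-((2 * (k + w)) * s))) / s +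
        (Real.exp (-((2 * (k + 1 - z)) * s)) - Real.exp (-((2 * (k + 1 - w)) * s))) / s) := by
  have hq : Real.exp (-2 * s) < 1 := by rw [Real.exp_lt_one_iff]; linarith
  have hsinh : Real.sinh s = Real.exp s * (1 - Real.exp (-2 * s)) / 2 := by
    rw [Real.sinh_eq, mul_sub, ← Real.exp_add]; congr 3 <;> ring
  have hcosh : ∀ z : ℝ, Real.cosh ((2 * z - 1) * s) = Real.exp s *
      (Real.exp (-((2 * z) * s)) + Real.exp (-((2 * (1 - z)) * s))) / 2 := by
    intro z
    rw [Real.cosh_eq, mul_add, ← Real.exp_add, ← Real.exp_add, add_comm]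
    congr 3 <;> ring
  have hsum : ∀ k : ℕ,
      ((Real.exp (-((2 * (k + z)) * s)) - Real.exp (-((2 * (k + w)) * s))) / s +
        (Real.exp (-((2 * (k + 1 - z)) * s)) - Real.exp (-((2 * (k + 1 - w)) * s))) / s) =
      Real.exp (-2 * s) ^ k * (((Real.exp (-((2 * z) * s)) + Real.exp (-((2 * (1 - z)) * s))) -
        (Real.exp (-((2 * w) * s)) + Real.exp (-((2 * (1 - w)) * s)))) / s) := by
    intro k
    rw [← Real.exp_nat_mul]
    have h1 : ∀ z : ℝ, Real.exp (-((2 * (k + z)) * s)) =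
        Real.exp (k * (-2 * s)) * Real.exp (-((2 * z) * s)) := by
      intro z; rw [← Real.exp_add]; congr 1; ring
    rw [add_sub_assoc, add_sub_assoc, h1, h1, h1, h1]
    ring
  simp_rw [hsum]
  rw [← Finset.sum_mul, geom_sum_eq hq.ne]
  unfold shiftKernel
  rw [hcosh, hcosh, hsinh]
  have h1 : 1 - Real.exp (-2 * s) ≠ 0 := by linarith
  have h2 := (Real.exp_pos s).ne'
  rw [← neg_sub 1 (Real.exp (-2 * s)), ← neg_sub 1 (Real.exp (-2 * s) ^ n), neg_div_neg_eq]
  generalize Real.exp (-(2 * z * s)) + _ = Z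
  generalize Real.exp (-(2 * w * s)) + _ = Z'
  generalize 1 - Real.exp (-2 * s) ^ n = Q
  generalize 1 - Real.exp (-2 * s) = q at *
  field_simp
  ring

theorem integral_shiftKernel_sub_mul {z w : ℝ} (hz0 : 0 < z) (hz1 : z < 1) (hw0 : 0 < w)
    (hw1 : w < 1) (n : ℕ) :
    ∫ s in Set.Ioi 0, (shiftKernel z s - shiftKernel w s) * (1 - Real.exp (-2 * s) ^ n) =
      Real.log (∏ k ∈ Finset.range n, ((k + w) * (k + 1 - w)) / ((k + z) * (k + 1 - z))) := by
  have hpos : ∀ (k : ℕ) (x : ℝ), 0 < x → x < 1 → 0 < 2 * (k + x) ∧ 0 < 2 * (k + 1 - x) := by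
    intro k x h0 h1
    have : (0 : ℝ) ≤ k := k.cast_nonneg
    constructor <;> linarith
  rw [setIntegral_congr_fun measurableSet_Ioi fun s hs => shiftKernel_sub_mul hs n,
    integral_finsetSum, Real.log_prod]
  · refine Finset.sum_congr rfl fun k _ => ?_
    obtain ⟨a1, a2⟩ := hpos k z hz0 hz1
    obtain ⟨b1, b2⟩ := hpos k w hw0 hw1
    rw [integral_add (integrableOn_exp_sub_exp_div a1 b1) (integrableOn_exp_sub_exp_div a2 b2),
      integral_exp_sub_exp_div a1 b1, integral_exp_sub_exp_div a2 b2, ← Real.log_mul]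
    · congr 1
      have := a1.ne'
      have := a2.ne'
      rw [mul_div_mul_left _ _ two_ne_zero, mul_div_mul_left _ _ two_ne_zero, div_mul_div_comm]
    · exact (div_pos b1 a1).ne'
    · exact (div_pos b2 a2).ne'
  · intro k _
    obtain ⟨a1, a2⟩ := hpos k z hz0 hz1
    obtain ⟨b1, b2⟩ := hpos k w hw0 hw1
    refine (div_pos (mul_pos ?_ ?_) (mul_pos ?_ ?_)).ne' <;> linarith
  · intro k _
    obtain ⟨a1, a2⟩ := hpos k z hz0 hz1
    obtain ⟨b1, b2⟩ := hpos k w hw0 hw1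
    exact (integrableOn_exp_sub_exp_div a1 b1).add (integrableOn_exp_sub_exp_div a2 b2)

theorem sin_pi_mul_pos {z : ℝ} (h0 : 0 < z) (h1 : z < 1) : 0 < Real.sin (Real.pi * z) :=
  Real.sin_pos_of_pos_of_lt_pi (by positivity) (by nlinarith [Real.pi_pos])

theorem tendsto_prod_div_prod_sin {z w : ℝ} (hz0 : 0 < z) (hz1 : z < 1) (hw0 : 0 < w) :
    Tendsto (fun n : ℕ => ∏ k ∈ Finset.range n,
      (((k : ℝ) + w) * (k + 1 - w)) / ((k + z) * (k + 1 - z))) atTop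
      (𝓝 (Real.sin (Real.pi * w) / Real.sin (Real.pi * z))) := by
  -- The factors k + x and k + 1 − x, together with the unpaired n + x, regroup into x and the pairs
  -- (j + 1)² − x² of Euler's sine product.
  have key : ∀ (x : ℝ) (n : ℕ), Real.pi * (∏ k ∈ Finset.range n, ((k : ℝ) + x) * (k + 1 - x)) *
      (n + x) = (Real.pi * x * ∏ j ∈ Finset.range n, ((1 : ℝ) - x ^ 2 / ((j : ℝ) + 1) ^ 2)) *
        ∏ j ∈ Finset.range n, ((j : ℝ) + 1) ^ 2 := by
    intro x n
    induction n with
    | zero => simp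
    | succ n ih =>
      simp only [Finset.prod_range_succ]
      have h1 : ((n : ℝ) + 1) ≠ 0 := by positivity
      have h2 : (1 - x ^ 2 / ((n : ℝ) + 1) ^ 2) * ((n : ℝ) + 1) ^ 2 =
          (n + 1 - x) * (n + 1 + x) := by
        field_simp; ring
      push_cast
      calc _ = (Real.pi * (∏ k ∈ Finset.range n, ((k : ℝ) + x) * (k + 1 - x)) * (n + x)) *
            ((n + 1 - x) * (n + 1 + x)) := by ring
        _ = _ := by rw [ih, ← h2]; ring
  have hlim := ((Real.tendsto_euler_sin_prod w).div (Real.tendsto_euler_sin_prod z)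
    (sin_pi_mul_pos hz0 hz1).ne')
  have hlim2 : Tendsto (fun n : ℕ => ((n : ℝ) + z) / (n + w)) atTop (𝓝 1) := by
    have h1 : Tendsto (fun n : ℕ => 1 + (z - w) / ((n : ℝ) + w)) atTop (𝓝 (1 + 0)) := by
      refine tendsto_const_nhds.add (Tendsto.const_div_atTop ?_ _)
      exact tendsto_atTop_add_const_right _ _ tendsto_natCast_atTop_atTop
    rw [add_zero] at h1
    refine h1.congr fun n => ?_
    have : (n : ℝ) + w ≠ 0 := by positivity
    field_simp
    ring
  have := hlim.mul hlim2
  rw [mul_one] at this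
  refine this.congr fun n => ?_
  rw [Finset.prod_div_distrib]
  have kz := key z n
  have kw := key w n
  have hP : (∏ j ∈ Finset.range n, ((j : ℝ) + 1) ^ 2) ≠ 0 :=
    Finset.prod_ne_zero_iff.2 fun j _ => by positivity
  have hEz : (∏ k ∈ Finset.range n, ((k : ℝ) + z) * (k + 1 - z)) ≠ 0 :=
    Finset.prod_ne_zero_iff.2 fun k _ => by
      have : (0 : ℝ) ≤ k := k.cast_nonneg
      exact (mul_pos (by linarith) (by linarith)).ne'
  have hnz : (n : ℝ) + z ≠ 0 := by positivity
  have hnw : (n : ℝ) + w ≠ 0 := by positivity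
  simp only [Pi.div_apply]
  rw [(eq_div_iff hP).2 kz.symm, (eq_div_iff hP).2 kw.symm]
  have := Real.pi_pos.ne'
  field_simp

/-- Let n → ∞ in `integral_shiftKernel_sub_mul`: dominated convergence on the left, Euler's sine
product on the right. -/
theorem integral_shiftKernel_sub {z w : ℝ} (hz0 : 0 < z) (hz1 : z < 1) (hw0 : 0 < w)
    (hw1 : w < 1) :
    (∫ s in Set.Ioi 0, shiftKernel z s) - ∫ s in Set.Ioi 0, shiftKernel w s =
      Real.log (Real.sin (Real.pi * w) / Real.sin (Real.pi * z)) := by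
  have hint := (integrableOn_shiftKernel hz0 hz1).sub (integrableOn_shiftKernel hw0 hw1)
  rw [← integral_sub (integrableOn_shiftKernel hz0 hz1) (integrableOn_shiftKernel hw0 hw1)]
  have hL : Tendsto (fun n : ℕ => ∫ s in Set.Ioi 0,
      (shiftKernel z s - shiftKernel w s) * (1 - Real.exp (-2 * s) ^ n)) atTop
      (𝓝 (∫ s in Set.Ioi 0, (shiftKernel z s - shiftKernel w s))) := by
    refine tendsto_integral_of_dominated_convergence
      (fun s => ‖shiftKernel z s - shiftKernel w s‖) ?_ hint.norm ?_ ?_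
    · intro n
      exact hint.aestronglyMeasurable.mul (by fun_prop)
    · intro n
      refine (ae_restrict_iff' measurableSet_Ioi).2 (ae_of_all _ fun s hs => ?_)
      have hs : 0 < s := hs
      have h1 : Real.exp (-2 * s) ^ n ≤ 1 :=
        pow_le_one₀ (Real.exp_pos _).le (Real.exp_le_one_iff.2 (by linarith))
      have h2 : 0 < Real.exp (-2 * s) ^ n := by positivity
      rw [norm_mul]
      refine mul_le_of_le_one_right (norm_nonneg _) ?_
      rw [Real.norm_eq_abs, abs_le]
      constructor <;> linarith
    · refine (ae_restrict_iff' measurableSet_Ioi).2 (ae_of_all _ fun s hs => ?_)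
      have hs : 0 < s := hs
      have h1 : Tendsto (fun n : ℕ => Real.exp (-2 * s) ^ n) atTop (𝓝 0) :=
        tendsto_pow_atTop_nhds_zero_of_lt_one (Real.exp_pos _).le
          (Real.exp_lt_one_iff.2 (by linarith))
      simpa using (tendsto_const_nhds (x := shiftKernel z s - shiftKernel w s)).mul
        ((tendsto_const_nhds (x := (1 : ℝ))).sub h1)
  simp_rw [integral_shiftKernel_sub_mul hz0 hz1 hw0 hw1] at hL
  refine tendsto_nhds_unique hL ?_
  have hne : Real.sin (Real.pi * w) / Real.sin (Real.pi * z) ≠ 0 :=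
    (div_pos (sin_pi_mul_pos hw0 hw1) (sin_pi_mul_pos hz0 hz1)).ne'
  exact (Real.continuousAt_log hne).tendsto.comp (tendsto_prod_div_prod_sin hz0 hz1 hw0)

/-- A duplication formula for the integrand. It fixes the additive constant that differences of
integrals leave undetermined. -/
theorem shiftKernel_quarter_add {s : ℝ} (hs : 0 < s) :
    shiftKernel (1 / 4) s + shiftKernel (3 / 4) s = 2⁻¹ * shiftKernel (1 / 2) (2⁻¹ * s) := by
  unfold shiftKernel
  have h1 : 0 < Real.sinh (2⁻¹ * s) := Real.sinh_pos_iff.2 (by positivity)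
  have h2 : 0 < Real.cosh (2⁻¹ * s) := Real.cosh_pos _
  have e1 : Real.sinh s = 2 * Real.sinh (2⁻¹ * s) * Real.cosh (2⁻¹ * s) := by
    rw [← Real.sinh_two_mul]; congr 1; ring
  have e2 : Real.cosh ((2 * (1 / 4) - 1) * s) = Real.cosh (2⁻¹ * s) := by
    rw [← Real.cosh_neg]; congr 1; ring
  have e3 : Real.cosh ((2 * (3 / 4) - 1) * s) = Real.cosh (2⁻¹ * s) := by
    congr 1; ring
  have e4 : Real.cosh ((2 * (1 / 2) - 1) * (2⁻¹ * s)) = 1 := by norm_num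
  rw [e1, e2, e3, e4]
  field_simp
  ring

/-- Let I(z) be the integral. Duplication gives I(1/4) + I(3/4) = I(1/2), while the known
differences make the left side 2I(1/2) + log 2. Hence I(1/2) = −log 2, and the other values follow
by difference. -/
theorem integral_shiftKernel {z : ℝ} (h0 : 0 < z) (h1 : z < 1) :
    ∫ s in Set.Ioi 0, shiftKernel z s = -logTwoSin z := by
  have i1 := integrableOn_shiftKernel (z := 1 / 4) (by norm_num) (by norm_num)
  have i2 := integrableOn_shiftKernel (z := 3 / 4) (by norm_num) (by norm_num)
  have hdup : (∫ s in Set.Ioi 0, shiftKernel (1 / 4) s) + ∫ s in Set.Ioi 0, shiftKernel (3 / 4) s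
      = ∫ s in Set.Ioi 0, shiftKernel (1 / 2) s := by
    rw [← integral_add i1 i2,
      setIntegral_congr_fun measurableSet_Ioi fun s hs => shiftKernel_quarter_add hs,
      integral_const_mul, integral_comp_mul_left_Ioi (fun s => shiftKernel (1 / 2) s) 0
        (by norm_num)]
    simp
  have a1 := integral_shiftKernel_sub (z := 1 / 4) (w := 1 / 2) (by norm_num) (by norm_num)
    (by norm_num) (by norm_num)
  have a2 := integral_shiftKernel_sub (z := 3 / 4) (w := 1 / 2) (by norm_num) (by norm_num)
    (by norm_num) (by norm_num)
  have a3 := integral_shiftKernel_sub (z := z) (w := 1 / 2) h0 h1 (by norm_num) (by norm_num)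
  have hsin : 0 < Real.sin (Real.pi * z) := sin_pi_mul_pos h0 h1
  have s1 : Real.sin (Real.pi * (1 / 2)) = 1 := by rw [mul_one_div, Real.sin_pi_div_two]
  have s2 : Real.sin (Real.pi * (1 / 4)) = √2 / 2 := by rw [mul_one_div, Real.sin_pi_div_four]
  have s3 : Real.sin (Real.pi * (3 / 4)) = √2 / 2 := by
    rw [show Real.pi * (3 / 4) = Real.pi - Real.pi / 4 by ring, Real.sin_pi_sub,
      Real.sin_pi_div_four]
  rw [s1, s2] at a1
  rw [s1, s3] at a2
  rw [s1, Real.log_div one_ne_zero hsin.ne', Real.log_one] at a3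
  have hl : Real.log (1 / (√2 / 2)) = Real.log 2 / 2 := by
    rw [one_div_div, Real.log_div two_ne_zero (by positivity), Real.log_sqrt (by norm_num)]
    ring
  rw [hl] at a1 a2
  unfold logTwoSin
  rw [abs_of_pos (by positivity), Real.log_mul two_ne_zero hsin.ne']
  linarith

/-- The functional equation of the double sine function under `z ↦ z + ω`. -/
theorem logSineIntegral_add_period {ω z : ℝ} (hω : 0 < ω) (h0 : 0 < z) (h1 : z < 1) :
    logSineIntegral ω 1 (2 * z + ω - 1) = logSineIntegral ω 1 (2 * z - ω - 1) - logTwoSin z := by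
  have := logSineIntegral_sub_eq_integral hω h0 h1
  rw [integral_shiftKernel h0 h1] at this
  linarith

theorem logSineIntegral_swap (α β c : ℝ) : logSineIntegral α β c = logSineIntegral β α c := by
  unfold logSineIntegral
  simp_rw [sineKernel_swap α β]

theorem logSineIntegral_neg (α β c : ℝ) : logSineIntegral α β (-c) = -logSineIntegral α β c := by
  unfold logSineIntegral
  simp_rw [sineKernel_neg, integral_neg]

theorem logSineIntegral_inv {ω : ℝ} (hω : 0 < ω) (c : ℝ) :
    logSineIntegral ω 1 c = logSineIntegral ω⁻¹ 1 (ω⁻¹ * c) := by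
  rw [logSineIntegral_swap ω 1, ← logSineIntegral_scale (inv_pos.2 hω), mul_one,
    inv_mul_cancel₀ hω.ne']

/-- The functional equation of the double sine function under `z ↦ z + 1`. -/
theorem logSineIntegral_add_one {ω z : ℝ} (hω : 0 < ω) (h0 : 0 < z) (h1 : z < ω) :
    logSineIntegral ω 1 (2 * z + 1 - ω) =
      logSineIntegral ω 1 (2 * z - ω - 1) - logTwoSin (z / ω) := by
  rw [logSineIntegral_inv hω, logSineIntegral_inv hω (2 * z - ω - 1)]
  convert logSineIntegral_add_period (inv_pos.2 hω) (div_pos h0 hω) ((div_lt_one hω).2 h1) using 2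
  · field_simp
  · congr 1
    field_simp
    ring

theorem doubleSine_inv {ω : ℝ} (hω : 0 < ω) (z : ℝ) :
    doubleSine ω z = doubleSine ω⁻¹ (z / ω) := by
  rw [doubleSine_eq_exp, doubleSine_eq_exp, logSineIntegral_inv hω]
  congr 2
  field_simp
  ring

/-! ### The special value at z = 1 -/

theorem tendsto_sin_pi_mul_div (ω : ℝ) :
    Tendsto (fun z : ℝ => z⁻¹ * Real.sin (Real.pi * (z / ω))) (𝓝[>] 0) (𝓝 (Real.pi / ω)) := by
  have h : HasDerivAt (fun z : ℝ => Real.sin (Real.pi * (z / ω))) (Real.pi / ω) 0 := by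
    have h1 : HasDerivAt (fun z : ℝ => Real.pi * (z / ω)) (Real.pi * (1 / ω)) 0 :=
      ((hasDerivAt_id (0 : ℝ)).div_const ω).const_mul Real.pi
    have h2 := h1.sin
    rwa [zero_div, mul_zero, Real.cos_zero, one_mul, mul_one_div] at h2
  have := h.tendsto_slope_zero_right
  simpa only [zero_add, zero_div, mul_zero, Real.sin_zero, sub_zero, smul_eq_mul] using this

theorem tendsto_logSineIntegral {ι : Type*} {l : Filter ι} {u v : ι → ℝ} {ω c : ℝ} (hω : 0 < ω)
    (hc : |c| < ω + 1) (hu : Tendsto u l (𝓝 ω)) (hv : Tendsto v l (𝓝 c)) :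
    Tendsto (fun i => logSineIntegral (u i) 1 (v i)) l (𝓝 (logSineIntegral ω 1 c)) := by
  have h1 := continuousAt_logSineIntegral hω hc
  generalize logSineIntegral = G at h1 ⊢
  exact h1.tendsto.comp (hu.prodMk_nhds hv)

/-- As z → 0⁺ the functional equations give 𝒮(z + 1)/𝒮(z + ω) = sin(πz)/sin(πz/ω) → ω, and oddness
in c gives 𝒮(1)𝒮(ω) = 1. Therefore 𝒮(1)² = ω. -/
theorem doubleSine_one {ω : ℝ} (hω : 0 < ω) : doubleSine ω 1 = √ω := by
  have t1 : Tendsto (fun z : ℝ => logSineIntegral ω 1 (2 * z + 1 - ω)) (𝓝[>] 0)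
      (𝓝 (logSineIntegral ω 1 (1 - ω))) := by
    refine tendsto_logSineIntegral hω (by rw [abs_lt]; constructor <;> linarith)
      tendsto_const_nhds (Tendsto.mono_left ?_ nhdsWithin_le_nhds)
    exact Continuous.tendsto' (by fun_prop) 0 _ (by simp)
  have t2 : Tendsto (fun z : ℝ => logSineIntegral ω 1 (2 * z + ω - 1)) (𝓝[>] 0)
      (𝓝 (logSineIntegral ω 1 (ω - 1))) := by
    refine tendsto_logSineIntegral hω (by rw [abs_lt]; constructor <;> linarith)
      tendsto_const_nhds (Tendsto.mono_left ?_ nhdsWithin_le_nhds)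
    exact Continuous.tendsto' (by fun_prop) 0 _ (by simp)
  have t3 : Tendsto (fun z : ℝ => Real.log ((z⁻¹ * Real.sin (Real.pi * (z / 1))) /
      (z⁻¹ * Real.sin (Real.pi * (z / ω))))) (𝓝[>] 0)
      (𝓝 (Real.log ((Real.pi / 1) / (Real.pi / ω)))) := by
    have := Real.pi_pos
    refine (Real.continuousAt_log (by positivity)).tendsto.comp ?_
    exact (tendsto_sin_pi_mul_div 1).div (tendsto_sin_pi_mul_div ω) (by positivity)
  have hev : ∀ᶠ z : ℝ in 𝓝[>] 0, 0 < z ∧ z < min 1 ω :=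
    Ioo_mem_nhdsGT (lt_min one_pos hω)
  have t4 := (t1.sub t2).congr' (f₂ := fun z : ℝ => Real.log ((z⁻¹ * Real.sin (Real.pi * (z / 1))) /
      (z⁻¹ * Real.sin (Real.pi * (z / ω))))) (by
    filter_upwards [hev] with z hz
    have hz1 : z < 1 := hz.2.trans_le (min_le_left _ _)
    have hz2 : z < ω := hz.2.trans_le (min_le_right _ _)
    have p1 := sin_pi_mul_pos hz.1 hz1
    have p2 := sin_pi_mul_pos (div_pos hz.1 hω) ((div_lt_one hω).2 hz2)
    rw [logSineIntegral_add_one hω hz.1 hz2, logSineIntegral_add_period hω hz.1 hz1, div_one,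
      mul_div_mul_left _ _ (inv_ne_zero hz.1.ne'), Real.log_div p1.ne' p2.ne', logTwoSin,
      logTwoSin, abs_of_pos (by positivity), abs_of_pos (by positivity),
      Real.log_mul two_ne_zero p1.ne', Real.log_mul two_ne_zero p2.ne']
    ring)
  have hlim := tendsto_nhds_unique t4 t3
  rw [← neg_sub 1 ω, logSineIntegral_neg, div_one, div_div_cancel₀ Real.pi_pos.ne'] at hlim
  rw [doubleSine_eq_exp, show 2 * 1 - ω - 1 = 1 - ω by ring,
    show logSineIntegral ω 1 (1 - ω) = Real.log √ω by rw [Real.log_sqrt hω.le]; linarith,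
    Real.exp_log (by positivity)]

/-! ### Multiplication formula for rational periods -/

/-- The logarithm of the double sine function with periods `1, 1`. -/
def logSineOne (w : ℝ) : ℝ := logSineIntegral 1 1 (2 * w - 2)

theorem sum_range_cast (n : ℕ) : ∑ i ∈ Finset.range n, (i : ℝ) = n * (n - 1) / 2 := by
  induction n with
  | zero => simp
  | succ n ih =>
    rw [Finset.sum_range_succ, ih]
    push_cast
    ring

/-- Multiplying by sinh x turns each summand into a difference of hyperbolic cosines, and the sum
telescopes. -/
theorem sum_sinh_mul_sinh (u x : ℝ) (n : ℕ) :
    (∑ i ∈ Finset.range n, Real.sinh (u + 2 * i * x)) * Real.sinh x =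
      Real.sinh (u + (n - 1) * x) * Real.sinh (n * x) := by
  have prod : ∀ a b : ℝ, Real.sinh a * Real.sinh b =
      (Real.cosh (a + b) - Real.cosh (a - b)) / 2 := by
    intro a b
    rw [Real.cosh_add, Real.cosh_sub]
    ring
  induction n with
  | zero => simp
  | succ n ih =>
    rw [Finset.sum_range_succ, add_mul, ih, prod, prod, prod]
    push_cast
    ring_nf

/-- Two summations of arithmetic progressions, in steps β and α, trade the denominators sinh(βs) and
sinh(αs) for sinh s. The linear correction terms add up to the right one, so the identity holds
before integration. -/
theorem sineKernel_eq_sum {α β s : ℝ} {m n : ℕ} (hα : n * α = 1) (hβ : m * β = 1) (hs : 0 < s)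
    (ζ : ℝ) :
    sineKernel α β (2 * ζ - α - β) s = ∑ i ∈ Finset.range n, ∑ j ∈ Finset.range m,
      sineKernel 1 1 (2 * (ζ + i * α + j * β) - 2) s := by
  have hα0 : 0 < α := pos_of_mul_pos_right (hα ▸ one_pos) n.cast_nonneg
  have hβ0 : 0 < β := pos_of_mul_pos_right (hβ ▸ one_pos) m.cast_nonneg
  have h1 : 0 < Real.sinh s := Real.sinh_pos_iff.2 hs
  have hA : 0 < Real.sinh (α * s) := Real.sinh_pos_iff.2 (by positivity)
  have hB : 0 < Real.sinh (β * s) := Real.sinh_pos_iff.2 (by positivity)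
  have hsum : (∑ i ∈ Finset.range n, ∑ j ∈ Finset.range m,
      Real.sinh ((2 * (ζ + i * α + j * β) - 2) * s)) * Real.sinh (β * s) * Real.sinh (α * s) =
      Real.sinh ((2 * ζ - α - β) * s) * Real.sinh s * Real.sinh s := by
    have e1 : ∀ i : ℕ, (∑ j ∈ Finset.range m,
        Real.sinh ((2 * (ζ + i * α + j * β) - 2) * s)) * Real.sinh (β * s) =
        Real.sinh ((2 * ζ - 1 - β) * s + 2 * i * (α * s)) * Real.sinh s := by
      intro i
      have := sum_sinh_mul_sinh ((2 * (ζ + i * α) - 2) * s) (β * s) m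
      rw [show (m : ℝ) * (β * s) = s by rw [← mul_assoc, hβ, one_mul],
        show (2 * (ζ + i * α) - 2) * s + ((m : ℝ) - 1) * (β * s) =
          (2 * ζ - 2 - β + m * β) * s + 2 * i * (α * s) by ring, hβ] at this
      rw [show 2 * ζ - 1 - β = 2 * ζ - 2 - β + 1 by ring, ← this]
      congr 1
      refine Finset.sum_congr rfl fun j _ => ?_
      congr 1
      ring
    rw [Finset.sum_mul, Finset.sum_congr rfl fun i _ => e1 i, ← Finset.sum_mul, mul_right_comm,
      sum_sinh_mul_sinh, show (n : ℝ) * (α * s) = s by rw [← mul_assoc, hα, one_mul],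
      show (2 * ζ - 1 - β) * s + ((n : ℝ) - 1) * (α * s) =
        (2 * ζ - 1 - β - α + n * α) * s by ring, hα]
    ring_nf
  have hlin : ∑ i ∈ Finset.range n, ∑ j ∈ Finset.range m, (2 * (ζ + i * α + j * β) - 2) =
      (2 * ζ - α - β) * (n * m) := by
    simp only [mul_add, add_sub_right_comm, Finset.sum_add_distrib, Finset.sum_const,
      Finset.card_range, nsmul_eq_mul, ← Finset.mul_sum, ← Finset.sum_mul, sum_range_cast]
    linear_combination (m * ((n : ℝ) - 1) + m) * hα + (n * ((m : ℝ) - 1) + n) * hβ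
  have hsplit : ∑ i ∈ Finset.range n, ∑ j ∈ Finset.range m,
      sineKernel 1 1 (2 * (ζ + i * α + j * β) - 2) s =
      ((∑ i ∈ Finset.range n, ∑ j ∈ Finset.range m,
        Real.sinh ((2 * (ζ + i * α + j * β) - 2) * s)) / (2 * Real.sinh s * Real.sinh s) -
      (∑ i ∈ Finset.range n, ∑ j ∈ Finset.range m, (2 * (ζ + i * α + j * β) - 2)) / (2 * s)) / s := by
    simp only [sineKernel, one_mul, mul_one, Finset.sum_div, ← Finset.sum_sub_distrib]
  rw [← eq_div_iff hA.ne', ← eq_div_iff hB.ne'] at hsum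
  rw [hsplit, hlin, hsum, sineKernel]
  have hn : (n : ℝ) = α⁻¹ := eq_inv_of_mul_eq_one_left hα
  have hm : (m : ℝ) = β⁻¹ := eq_inv_of_mul_eq_one_left hβ
  rw [hn, hm]
  field_simp

theorem logSineIntegral_eq_sum {m n : ℕ} (hm : 0 < m) (hn : 0 < n) {z : ℝ} (h0 : 0 < z)
    (h1 : z < 1 + m / n) :
    logSineIntegral (m / n) 1 (2 * z - m / n - 1) =
      ∑ i ∈ Finset.range n, ∑ j ∈ Finset.range m, logSineOne (z / m + i / n + j / m) := by
  have hm' : (0 : ℝ) < m := Nat.cast_pos.2 hm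
  have hn' : (0 : ℝ) < n := Nat.cast_pos.2 hn
  -- Scaling by 1/m turns the periods m/n and 1 into 1/n and 1/m.
  rw [← logSineIntegral_scale (inv_pos.2 hm')]
  have e1 : (m : ℝ)⁻¹ * (m / n) = 1 / n := by field_simp
  have e2 : (m : ℝ)⁻¹ * (2 * z - m / n - 1) = 2 * (z / m) - 1 / n - 1 / m := by field_simp
  have e3 : (m : ℝ)⁻¹ * 1 = 1 / m := by field_simp
  rw [e1, e2, e3]
  have hz : z / m < 1 / m + 1 / n := by
    calc z / m < (1 + m / n) / m := by gcongr
      _ = 1 / m + 1 / n := by field_simp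
  unfold logSineOne logSineIntegral
  rw [setIntegral_congr_fun measurableSet_Ioi fun s hs =>
    sineKernel_eq_sum (mul_one_div_cancel hn'.ne') (mul_one_div_cancel hm'.ne') hs (z / m)]
  have hint : ∀ i ∈ Finset.range n, ∀ j ∈ Finset.range m, IntegrableOn
      (fun s => sineKernel 1 1 (2 * (z / m + i * (1 / n) + j * (1 / m)) - 2) s) (Set.Ioi 0) := by
    intro i hi j hj
    refine integrableOn_sineKernel one_pos one_pos ?_
    have hi' : (i : ℝ) + 1 ≤ n := by exact_mod_cast Finset.mem_range.1 hi
    have hj' : (j : ℝ) + 1 ≤ m := by exact_mod_cast Finset.mem_range.1 hj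
    have a1 : ((i : ℝ) + 1) * (1 / n) ≤ n * (1 / n) := by gcongr
    have a2 : ((j : ℝ) + 1) * (1 / m) ≤ m * (1 / m) := by gcongr
    rw [mul_one_div_cancel hn'.ne'] at a1
    rw [mul_one_div_cancel hm'.ne'] at a2
    have a3 : 0 < z / m + i * (1 / n) + j * (1 / m) := by positivity
    rw [abs_lt]
    constructor <;> linarith
  rw [integral_finsetSum _ fun i hi => integrable_finsetSum _ (hint i hi)]
  refine Finset.sum_congr rfl fun i hi => ?_
  rw [integral_finsetSum _ (hint i hi)]
  refine Finset.sum_congr rfl fun j _ => ?_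
  rw [mul_one_div, mul_one_div]

/-! ### Distribution relations and the periodic part -/

theorem norm_one_sub_exp (x : ℝ) :
    ‖1 - Complex.exp (2 * Real.pi * Complex.I * x)‖ = |2 * Real.sin (Real.pi * x)| := by
  rw [norm_sub_rev, show 2 * Real.pi * Complex.I * x = Complex.I * ((2 * Real.pi * x : ℝ) : ℂ) by
    push_cast; ring, Complex.norm_exp_I_mul_ofReal_sub_one, Real.norm_eq_abs]
  congr 3
  ring

theorem sin_pi_mul_ne_zero {x : ℝ} (hx : Int.fract x ≠ 0) : Real.sin (Real.pi * x) ≠ 0 := by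
  intro h
  obtain ⟨k, hk⟩ := Real.sin_eq_zero_iff.1 h
  rw [mul_comm] at hk
  rw [← mul_left_cancel₀ Real.pi_pos.ne' hk, Int.fract_intCast] at hx
  exact hx rfl

theorem fract_ne_zero_of_natCast_mul {n : ℕ} {x : ℝ} (h : Int.fract (n * x) ≠ 0) :
    Int.fract x ≠ 0 := by
  intro hx
  obtain ⟨k, rfl⟩ := Int.fract_eq_zero_iff.1 hx
  apply h
  rw [Int.fract_eq_zero_iff]
  exact ⟨n * k, by push_cast; rfl⟩

theorem prod_one_sub_exp {N : ℕ} (hN : 0 < N) (v : ℝ) :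
    ∏ j ∈ Finset.range N, (1 - Complex.exp (2 * Real.pi * Complex.I * ((v + j / N : ℝ) : ℂ))) =
      1 - Complex.exp (2 * Real.pi * Complex.I * ((N * v : ℝ) : ℂ)) := by
  have hζ := Complex.isPrimitiveRoot_exp N hN.ne'
  have h := X_pow_sub_C_eq_prod hζ hN
    (show Complex.exp (2 * Real.pi * Complex.I * (v : ℂ)) ^ N =
      Complex.exp (2 * Real.pi * Complex.I * ((N * v : ℝ) : ℂ)) by
        rw [← Complex.exp_nat_mul]; congr 1; push_cast; ring)
  have h2 := congrArg (Polynomial.eval 1) h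
  simp only [Polynomial.eval_sub, Polynomial.eval_pow, Polynomial.eval_X, Polynomial.eval_C,
    one_pow, Polynomial.eval_prod] at h2
  rw [h2]
  refine Finset.prod_congr rfl fun j _ => ?_
  rw [← Complex.exp_nat_mul, ← Complex.exp_add]
  congr 2
  push_cast
  ring

/-- The distribution relation of `log |2 sin (π x)|`. -/
theorem sum_logTwoSin {N : ℕ} (hN : 0 < N) {v : ℝ} (hv : Int.fract (N * v) ≠ 0) :
    ∑ j ∈ Finset.range N, logTwoSin (v + j / N) = logTwoSin (N * v) := by
  unfold logTwoSin
  have h := congrArg norm (prod_one_sub_exp hN v)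
  rw [norm_prod, norm_one_sub_exp] at h
  simp only [norm_one_sub_exp] at h
  rw [← h, Real.log_prod]
  intro j _ h0
  have : |2 * Real.sin (Real.pi * (N * v))| = 0 := by
    rw [← h]
    exact Finset.prod_eq_zero (by assumption) h0
  rw [abs_eq_zero] at this
  exact mul_ne_zero two_ne_zero (sin_pi_mul_ne_zero hv) this

/-- Multiplication by m permutes the residues modulo n, and F depends only on the class modulo 1. -/
theorem sum_range_mul_div_of_coprime {F : ℝ → ℝ} (hF : Function.Periodic F 1) {m n : ℕ}
    (hn : 0 < n) (hmn : Nat.Coprime m n) (z : ℝ) :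
    ∑ i ∈ Finset.range n, F (z + i * m / n) = ∑ i ∈ Finset.range n, F (z + i / n) := by
  have hmaps : Set.MapsTo (fun i => i * m % n) (Finset.range n : Set ℕ) (Finset.range n) :=
    fun i _ => by simpa using Nat.mod_lt _ hn
  have hinj : Set.InjOn (fun i => i * m % n) (Finset.range n : Set ℕ) := by
    intro i hi j hj hij
    simp only [Finset.coe_range, Set.mem_Iio] at hi hj
    have h : i ≡ j [MOD n] := Nat.ModEq.cancel_right_of_coprime (hmn.symm) hij
    exact Nat.ModEq.eq_of_lt_of_lt h hi hj
  refine Finset.sum_nbij (fun i => i * m % n) hmaps hinj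
    (Finset.surjOn_of_injOn_of_card_le _ hmaps hinj le_rfl) fun i _ => ?_
  have hn' : (n : ℝ) ≠ 0 := Nat.cast_ne_zero.2 hn.ne'
  have h : ((i * m : ℕ) : ℝ) = ((n * (i * m / n) + i * m % n : ℕ) : ℝ) := by
    rw [Nat.div_add_mod]
  have e : z + i * m / n = z + ((i * m % n : ℕ) : ℝ) / n + ((i * m / n : ℕ) : ℝ) * 1 := by
    push_cast at h
    rw [h]
    field_simp
    ring
  rw [e, hF.nat_mul]

/-- The periodic correction term in `logSineOne w = (1 - w) * logTwoSin w + clausen w`. -/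
def clausen (x : ℝ) : ℝ := logSineOne (Int.fract x) - (1 - Int.fract x) * logTwoSin x

theorem periodic_clausen : Function.Periodic clausen 1 := by
  intro x
  rw [clausen, Int.fract_add_one, logTwoSin_add_one, clausen]

/-- On (0, 1) this is the definition of `clausen`. On (1, 2) the functional equation subtracts one
`logTwoSin`, which is exactly the change of the factor 1 − w. -/
theorem logSineOne_eq {w : ℝ} (h0 : 0 < w) (h2 : w < 2) (hw : Int.fract w ≠ 0) :
    logSineOne w = (1 - w) * logTwoSin w + clausen w := by
  rcases lt_or_ge w 1 with h | h
  · rw [clausen, Int.fract_eq_self.2 ⟨h0.le, h⟩]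
    ring
  · obtain ⟨z, rfl⟩ : ∃ z, w = z + 1 := ⟨w - 1, by ring⟩
    have hz : Int.fract z = z := Int.fract_eq_self.2 ⟨by linarith, by linarith⟩
    rw [Int.fract_add_one, hz] at hw
    have hz0 : 0 < z := lt_of_le_of_ne (by linarith) hw.symm
    have hs := logSineIntegral_add_period (z := z) one_pos hz0 (by linarith)
    rw [clausen, Int.fract_add_one, hz, logTwoSin_add_one, logSineOne, logSineOne,
      show 2 * (z + 1) - 2 = 2 * z + 1 - 1 by ring, hs, show 2 * z - 2 = 2 * z - 1 - 1 by ring]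
    ring

theorem periodic_sum_range {F : ℝ → ℝ} (hF : Function.Periodic F 1) {N : ℕ} (hN : 0 < N) :
    Function.Periodic (fun x => ∑ j ∈ Finset.range N, F (x / N + j / N)) 1 := by
  intro x
  have hN' : (N : ℝ) ≠ 0 := Nat.cast_ne_zero.2 hN.ne'
  have h := Finset.sum_range_succ' (fun j : ℕ => F (x / N + j / N)) N
  rw [Finset.sum_range_succ] at h
  have e : F (x / N + N / N) = F (x / N + (0 : ℕ) / N) := by
    rw [div_self hN', hF, Nat.cast_zero, zero_div, add_zero]
  rw [e, add_left_inj] at h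
  beta_reduce
  rw [h]
  refine Finset.sum_congr rfl fun j _ => ?_
  congr 1
  push_cast
  ring

theorem add_div_nat_bounds {i N : ℕ} (hi : i < N) : (i : ℝ) / N + 1 / N ≤ 1 := by
  have hN : (0 : ℝ) < N := Nat.cast_pos.2 (by omega)
  rw [← add_div, div_le_one hN]
  exact_mod_cast hi

/-- The multiplication formula in terms of `logTwoSin` and `clausen`. -/
theorem logSineIntegral_eq_sum_clausen {m n : ℕ} (hm : 0 < m) (hn : 0 < n) {z : ℝ}
    (h0 : 0 < z) (h1 : z < 1 + m / n) (hz : Int.fract (n * z) ≠ 0) :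
    logSineIntegral (m / n) 1 (2 * z - m / n - 1) =
      ∑ i ∈ Finset.range n, ∑ j ∈ Finset.range m,
        ((1 - (z / m + i / n + j / m)) * logTwoSin (z / m + i / n + j / m) +
          clausen (z / m + i / n + j / m)) := by
  rw [logSineIntegral_eq_sum hm hn h0 h1]
  have hm' : (0 : ℝ) < m := Nat.cast_pos.2 hm
  have hn' : (0 : ℝ) < n := Nat.cast_pos.2 hn
  refine Finset.sum_congr rfl fun i hi => Finset.sum_congr rfl fun j hj => ?_
  have hi' := add_div_nat_bounds (Finset.mem_range.1 hi)
  have hj' := add_div_nat_bounds (Finset.mem_range.1 hj)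
  have hzm : z / m < 1 / m + 1 / n := by
    calc z / m < (1 + m / n) / m := by gcongr
      _ = 1 / m + 1 / n := by field_simp
  refine logSineOne_eq (by positivity) (by linarith) ?_
  refine fract_ne_zero_of_natCast_mul (n := m * n) ?_
  rw [show ((m * n : ℕ) : ℝ) * (z / m + i / n + j / m) = n * z + ((m * i + n * j : ℕ) : ℝ) by
    push_cast; field_simp; ring, Int.fract_add_natCast]
  exact hz

/-- The distribution relation of `clausen`. -/
theorem sum_clausen {N : ℕ} (hN : 0 < N) {v : ℝ} (hv : Int.fract (N * v) ≠ 0) :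
    ∑ j ∈ Finset.range N, clausen (v + j / N) = clausen (N * v) / N := by
  have hN' : (0 : ℝ) < N := Nat.cast_pos.2 hN
  -- Apply the multiplication formula with m = n = N to the value at z. The log-sine terms on both
  -- sides agree, and what remains is N ∑ clausen = clausen z.
  have key : ∀ z : ℝ, 0 < z → z < 1 →
      ∑ j ∈ Finset.range N, clausen (z / N + j / N) = clausen z / N := by
    intro z h0 h1
    have hz : Int.fract z ≠ 0 := by rw [Int.fract_eq_self.2 ⟨h0.le, h1⟩]; exact h0.ne'
    have hL : logSineIntegral 1 1 (2 * z - 1 - 1) = ∑ i ∈ Finset.range N, ∑ j ∈ Finset.range N,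
        logSineOne (z / N + i / N + j / N) := by
      have := logSineIntegral_eq_sum hN hN h0 (by rw [div_self hN'.ne']; linarith)
      rwa [div_self hN'.ne'] at this
    have hterm : ∀ i ∈ Finset.range N, ∑ j ∈ Finset.range N,
        logSineOne (z / N + i / N + j / N) =
        (1 - z / N - i / N) * logTwoSin z -
          ∑ j ∈ Finset.range N, j / N * logTwoSin (z / N + i / N + j / N) +
          ∑ j ∈ Finset.range N, clausen (z / N + j / N) := by
      intro i hi
      have hfi : ∑ j ∈ Finset.range N, logTwoSin (z / N + i / N + j / N) = logTwoSin z := by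
        have e : N * (z / N + i / N) = z + (i : ℝ) * 1 := by field_simp
        rw [sum_logTwoSin hN (by rw [e, mul_one, Int.fract_add_natCast]; exact hz), e,
          periodic_logTwoSin.nat_mul]
      have hci : ∑ j ∈ Finset.range N, clausen (z / N + i / N + j / N) =
          ∑ j ∈ Finset.range N, clausen (z / N + j / N) := by
        have := (periodic_sum_range periodic_clausen hN).nat_mul i z
        rw [mul_one] at this
        simpa only [add_div] using this
      rw [← hfi, ← hci, Finset.mul_sum, ← Finset.sum_sub_distrib, ← Finset.sum_add_distrib]
      refine Finset.sum_congr rfl fun j hj => ?_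
      have hi' := add_div_nat_bounds (Finset.mem_range.1 hi)
      have hj' := add_div_nat_bounds (Finset.mem_range.1 hj)
      have hzN : z / N < 1 / N := by gcongr
      have : (0 : ℝ) < 1 / N := by positivity
      rw [logSineOne_eq (by positivity) (by linarith)]
      · ring
      · refine fract_ne_zero_of_natCast_mul (n := N) ?_
        rw [show (N : ℝ) * (z / N + i / N + j / N) = z + ((i + j : ℕ) : ℝ) by
          push_cast; field_simp; ring, Int.fract_add_natCast]
        exact hz
    have hswap : ∑ i ∈ Finset.range N, ∑ j ∈ Finset.range N,
        (j : ℝ) / N * logTwoSin (z / N + i / N + j / N) =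
        ∑ j ∈ Finset.range N, (j : ℝ) / N * logTwoSin z := by
      rw [Finset.sum_comm]
      refine Finset.sum_congr rfl fun j _ => ?_
      rw [← Finset.mul_sum]
      congr 1
      have e : N * (z / N + j / N) = z + (j : ℝ) * 1 := by field_simp
      rw [← periodic_logTwoSin.nat_mul j z, ← e, ← sum_logTwoSin hN
        (by rw [e, mul_one, Int.fract_add_natCast]; exact hz)]
      exact Finset.sum_congr rfl fun i _ => by rw [add_right_comm]
    rw [Finset.sum_congr rfl hterm, Finset.sum_add_distrib, Finset.sum_sub_distrib, hswap,
      ← Finset.sum_mul, ← Finset.sum_mul, ← Finset.sum_div, sum_range_cast,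
      Finset.sum_sub_distrib, ← Finset.sum_div, sum_range_cast, Finset.sum_const,
      Finset.sum_const, Finset.card_range, nsmul_eq_mul, nsmul_eq_mul] at hL
    have hone : logSineOne z = (1 - z) * logTwoSin z + clausen z :=
      logSineOne_eq h0 (by linarith) hz
    rw [logSineOne, show 2 * z - 2 = 2 * z - 1 - 1 by ring, hL] at hone
    rw [eq_div_iff hN'.ne']
    have e : (N * (1 - z / N) - N * (N - 1) / 2 / N) * logTwoSin z -
        N * (N - 1) / 2 / N * logTwoSin z = (1 - z) * logTwoSin z := by
      field_simp
      ring
    linarith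
  have h0 : 0 < Int.fract (N * v) := lt_of_le_of_ne (Int.fract_nonneg _) hv.symm
  have h := key _ h0 (Int.fract_lt_one _)
  -- Both sides have period one in N v, so the case of an argument in (0, 1) suffices.
  rw [← Int.self_sub_floor, ← mul_one ((⌊(N : ℝ) * v⌋ : ℤ) : ℝ),
    periodic_clausen.sub_int_mul_eq,
    (periodic_sum_range periodic_clausen hN).sub_int_mul_eq] at h
  rwa [mul_div_cancel_left₀ _ hN'.ne'] at h

/-! ### Rational periods and reciprocity -/

/-- The sum `∑ (k / n) log |2 sin (π (z + k t))|` over `0 ≤ k < n`. -/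
def weightedLogSine (n : ℕ) (t z : ℝ) : ℝ :=
  ∑ k ∈ Finset.range n, (k : ℝ) / n * logTwoSin (z + k * t)

/-- The double sine function with rational period in terms of finite sums. -/
theorem logSineIntegral_rat {m n : ℕ} (hm : 0 < m) (hn : 0 < n) (hmn : Nat.Coprime m n) {z : ℝ}
    (h0 : 0 < z) (h1 : z < 1 + m / n) (hz : Int.fract (n * z) ≠ 0) :
    logSineIntegral (m / n) 1 (2 * z - m / n - 1) =
      (1 - z / m) * logTwoSin (n * z) - weightedLogSine n (m / n) z -
      weightedLogSine m (n / m) (n * z / m) + clausen (n * z) / (m * n) := by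
  have hm' : (0 : ℝ) < m := Nat.cast_pos.2 hm
  have hn' : (0 : ℝ) < n := Nat.cast_pos.2 hn
  have hmi : ∀ i : ℕ, m * (z / m + i / n) = z + i * m / n := fun i => by field_simp
  have hni : ∀ j : ℕ, n * (z / m + j / m) = n * z / m + j * n / m := fun j => by field_simp
  have fmi : ∀ i : ℕ, Int.fract (m * (z / m + i / n)) ≠ 0 := fun i => by
    refine fract_ne_zero_of_natCast_mul (n := n) ?_
    rw [show (n : ℝ) * (m * (z / m + i / n)) = n * z + ((m * i : ℕ) : ℝ) by
      push_cast; field_simp, Int.fract_add_natCast]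
    exact hz
  have fni : ∀ j : ℕ, Int.fract (n * (z / m + j / m)) ≠ 0 := fun j => by
    refine fract_ne_zero_of_natCast_mul (n := m) ?_
    rw [show (m : ℝ) * (n * (z / m + j / m)) = n * z + ((n * j : ℕ) : ℝ) by
      push_cast; field_simp, Int.fract_add_natCast]
    exact hz
  have sA : ∀ i : ℕ, ∑ j ∈ Finset.range m, logTwoSin (z / m + i / n + j / m) =
      logTwoSin (z + i * m / n) := fun i => by rw [sum_logTwoSin hm (fmi i), hmi]
  have sB : ∀ j : ℕ, ∑ i ∈ Finset.range n, logTwoSin (z / m + i / n + j / m) =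
      logTwoSin (n * z / m + j * n / m) := fun j => by
    rw [← hni, ← sum_logTwoSin hn (fni j)]
    exact Finset.sum_congr rfl fun i _ => by rw [add_right_comm]
  have sC : ∀ i : ℕ, ∑ j ∈ Finset.range m, clausen (z / m + i / n + j / m) =
      clausen (z + i * m / n) / m := fun i => by rw [sum_clausen hm (fmi i), hmi]
  have sA' : ∑ i ∈ Finset.range n, logTwoSin (z + i * m / n) = logTwoSin (n * z) := by
    rw [sum_range_mul_div_of_coprime periodic_logTwoSin hn hmn, sum_logTwoSin hn hz]
  have sC' : ∑ i ∈ Finset.range n, clausen (z + i * m / n) = clausen (n * z) / n := by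
    rw [sum_range_mul_div_of_coprime periodic_clausen hn hmn, sum_clausen hn hz]
  -- The weight j/m does not depend on i, so here the distribution relation is applied to the sum
  -- over i; for the weight i/n it is applied to the sum over j.
  have hswap : ∑ i ∈ Finset.range n, ∑ j ∈ Finset.range m,
      (j : ℝ) / m * logTwoSin (z / m + i / n + j / m) = weightedLogSine m (n / m) (n * z / m) := by
    rw [Finset.sum_comm]
    refine Finset.sum_congr rfl fun j _ => ?_
    rw [← Finset.mul_sum, sB, mul_div_assoc (j : ℝ)]
  have hterm : ∀ i ∈ Finset.range n, ∑ j ∈ Finset.range m,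
      ((1 - (z / m + i / n + j / m)) * logTwoSin (z / m + i / n + j / m) +
        clausen (z / m + i / n + j / m)) =
      (1 - z / m) * logTwoSin (z + i * m / n) - i / n * logTwoSin (z + i * (m / n)) -
        ∑ j ∈ Finset.range m, (j : ℝ) / m * logTwoSin (z / m + i / n + j / m) +
        clausen (z + i * m / n) / m := by
    intro i _
    rw [← mul_div_assoc (i : ℝ) (m : ℝ), ← sub_mul, ← sC, ← sA, Finset.mul_sum,
      ← Finset.sum_sub_distrib, ← Finset.sum_add_distrib]
    exact Finset.sum_congr rfl fun j _ => by ring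
  rw [logSineIntegral_eq_sum_clausen hm hn h0 h1 hz, Finset.sum_congr rfl hterm,
    Finset.sum_add_distrib, Finset.sum_sub_distrib, Finset.sum_sub_distrib, ← Finset.mul_sum, sA',
    hswap, ← Finset.sum_div, sC', ← weightedLogSine, div_div, mul_comm (n : ℝ) (m : ℝ)]

/-- Reciprocity for the weighted sums: the double sine function with period `m / n` relates the
sums for `m / n` and for `a - n / m`. -/
theorem logSineIntegral_reciprocity {m n : ℕ} (hm : 0 < m) (hn : 0 < n) (hmn : Nat.Coprime m n)
    {z : ℝ} (h0 : 0 < z) (h1 : z < 1 + m / n) (hz : Int.fract (n * z) ≠ 0) (a : ℤ) :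
    logSineIntegral (m / n) 1 (2 * z - m / n - 1) =
      weightedLogSine m (a - n / m) (n * z / m + (a - n / m)) - weightedLogSine n (m / n) z +
      ((1 - z) * logTwoSin (n * z) + clausen (n * z) / n) / m := by
  have hm' : (0 : ℝ) < m := Nat.cast_pos.2 hm
  have hn' : (0 : ℝ) < n := Nat.cast_pos.2 hn
  have hzm : (m : ℝ) * (n * z / m) = n * z := by field_simp
  have hsum : ∑ j ∈ Finset.range m, logTwoSin (n * z / m + j * (n / m)) = logTwoSin (n * z) := by
    simp_rw [← mul_div_assoc]
    rw [sum_range_mul_div_of_coprime periodic_logTwoSin hm hmn.symm,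
      sum_logTwoSin hm (by rwa [hzm]), hzm]
  -- Reflection j ↦ m − 1 − j changes the weight j/m into 1 − 1/m − j/m and, modulo integers, the
  -- slope n/m into a − n/m.
  have hrefl : weightedLogSine m (a - n / m) (n * z / m + (a - n / m)) =
      (1 - 1 / m) * logTwoSin (n * z) - weightedLogSine m (n / m) (n * z / m) := by
    rw [← hsum, Finset.mul_sum, weightedLogSine, weightedLogSine, ← Finset.sum_range_reflect,
      ← Finset.sum_sub_distrib]
    refine Finset.sum_congr rfl fun j hj => ?_
    have hcast : ((m - 1 - j : ℕ) : ℝ) = m - 1 - j := by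
      have := Finset.mem_range.1 hj
      rw [Nat.cast_sub (by omega), Nat.cast_sub (by omega), Nat.cast_one]
    rw [hcast, ← sub_mul]
    have e : n * z / m + (a - n / m) + (m - 1 - j) * (a - n / m) =
        n * z / m + j * (n / m) + (((m : ℤ) - j) * a - n : ℤ) * 1 := by
      push_cast
      field_simp
      ring
    rw [e, periodic_logTwoSin.int_mul]
    congr 1
    field_simp
  rw [logSineIntegral_rat hm hn hmn h0 h1 hz, hrefl]
  field_simp
  ring

/-- A function of period one is bounded on the multiples of `1 / q`. -/
theorem exists_bound_periodic {F : ℝ → ℝ} (hF : Function.Periodic F 1) {q : ℕ} (hq : 0 < q) :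
    ∃ B : ℝ, 0 ≤ B ∧ ∀ x : ℝ, (∃ k : ℤ, q * x = k) → |F x| ≤ B := by
  refine ⟨∑ r ∈ Finset.range q, |F (r / q)|, Finset.sum_nonneg fun _ _ => abs_nonneg _, ?_⟩
  rintro x ⟨k, hk⟩
  have hq' : (q : ℝ) ≠ 0 := Nat.cast_ne_zero.2 hq.ne'
  have hqz : (q : ℤ) ≠ 0 := by exact_mod_cast hq.ne'
  obtain ⟨r, hr⟩ := Int.eq_ofNat_of_zero_le (Int.emod_nonneg k hqz)
  have hrq : r < q := by
    have := Int.emod_lt_of_pos k (show (0 : ℤ) < q by exact_mod_cast hq)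
    omega
  have hx : x = r / q + (k / q : ℤ) * 1 := by
    have h : (k : ℝ) = (q * (k / q) + r : ℤ) := by rw [← hr, Int.mul_ediv_add_emod]
    rw [eq_div_of_mul_eq hq' ((mul_comm _ _).trans hk), h]
    push_cast
    field_simp
    ring
  rw [hx, hF.int_mul]
  exact Finset.single_le_sum (f := fun r : ℕ => |F (r / q)|) (fun _ _ => abs_nonneg _)
    (Finset.mem_range.2 hrq)

/-! ### The sequence of cusps -/

theorem chebyshevT_add_two (a : ℕ) (n : ℕ) :
    chebyshevT a ((n + 2 : ℕ) : ℤ) = a * chebyshevT a ((n + 1 : ℕ) : ℤ) - chebyshevT a (n : ℤ) := by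
  unfold chebyshevT
  push_cast
  rw [Polynomial.Chebyshev.C_add_two]
  simp

theorem chebyshevT_pos_lt {a : ℕ} (ha : 3 ≤ a) (n : ℕ) :
    0 < chebyshevT a (n : ℤ) ∧ chebyshevT a (n : ℤ) < chebyshevT a ((n + 1 : ℕ) : ℤ) := by
  have ha' : (3 : ℤ) ≤ a := by exact_mod_cast ha
  induction n with
  | zero =>
    simp only [chebyshevT, Nat.cast_zero, Polynomial.Chebyshev.C_zero, zero_add, Nat.cast_one,
      Polynomial.Chebyshev.C_one, Polynomial.eval_X]
    have : (Polynomial.eval (a : ℤ) 2) = 2 := Polynomial.eval_ofNat 2 _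
    rw [this]
    omega
  | succ n ih =>
    rw [chebyshevT_add_two]
    exact ⟨ih.1.trans ih.2, by nlinarith [ih.1, ih.2]⟩

theorem cuspSeq_succ (a n : ℕ) :
    cuspSeq a (n + 1) = (chebyshevT a (n : ℤ) : ℚ) / (chebyshevT a ((n + 1 : ℕ) : ℤ) : ℚ) := by
  unfold cuspSeq
  rw [show ((n + 1 : ℕ) : ℤ) - 1 = n by push_cast; ring]

theorem cuspSeq_lt_one {a n : ℕ} (ha : 3 ≤ a) (hn : 1 ≤ n) : cuspSeq a n < 1 := by
  obtain ⟨n, rfl⟩ := Nat.exists_eq_succ_of_ne_zero (show n ≠ 0 by omega)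
  rw [Nat.succ_eq_add_one, cuspSeq_succ]
  have h := chebyshevT_pos_lt ha n
  rw [div_lt_one (by exact_mod_cast h.1.trans h.2)]
  exact_mod_cast h.2

theorem cuspSeq_recursion {a n : ℕ} (ha : 3 ≤ a) (hn : 1 ≤ n) :
    cuspSeq a (n + 1) = 1 / (a - cuspSeq a n) := by
  obtain ⟨n, rfl⟩ := Nat.exists_eq_succ_of_ne_zero (show n ≠ 0 by omega)
  rw [Nat.succ_eq_add_one, cuspSeq_succ, cuspSeq_succ, chebyshevT_add_two]
  have h := chebyshevT_pos_lt ha n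
  have h2 := chebyshevT_pos_lt ha (n + 1)
  rw [chebyshevT_add_two] at h2
  have h3 : (chebyshevT a ((n + 1 : ℕ) : ℤ) : ℚ) ≠ 0 := by exact_mod_cast h2.1.ne'
  have h4 : (a : ℚ) * chebyshevT a ((n + 1 : ℕ) : ℤ) - chebyshevT a (n : ℤ) ≠ 0 := by
    exact_mod_cast (h2.1.trans h2.2).ne'
  push_cast at h3 h4 ⊢
  rw [show (a : ℚ) - chebyshevT a (n : ℤ) / chebyshevT a ((n : ℤ) + 1) =
    (a * chebyshevT a ((n : ℤ) + 1) - chebyshevT a (n : ℤ)) / chebyshevT a ((n : ℤ) + 1) by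
      field_simp, one_div_div]

/-- The values T_n(a) need not be coprime, so the reduced fraction is followed directly: t ↦ 1/(a −
t) acts by an integral matrix of determinant 1, which preserves coprimality. Consecutive
denominators then serve as m and n in the reciprocity law. -/
theorem cuspSeq_num_den_succ {a n : ℕ} (ha : 3 ≤ a) (hn : 1 ≤ n) :
    (cuspSeq a (n + 1)).num = (cuspSeq a n).den ∧
      ((cuspSeq a (n + 1)).den : ℤ) = a * (cuspSeq a n).den - (cuspSeq a n).num := by
  set t := cuspSeq a n with ht
  have hd : (0 : ℤ) < t.den := by exact_mod_cast t.den_pos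
  have hlt : t.num < t.den := by
    have := cuspSeq_lt_one ha hn
    rwa [← ht, Rat.lt_iff, Rat.num_one, Rat.den_one, Nat.cast_one, mul_one, one_mul] at this
  have ha' : (3 : ℤ) ≤ a := by exact_mod_cast ha
  have hpos : 0 < (a : ℤ) * t.den - t.num := by nlinarith
  have hcop : Nat.Coprime (t.den : ℤ).natAbs ((a : ℤ) * t.den - t.num).natAbs := by
    rw [← Int.isCoprime_iff_nat_coprime]
    have h1 : IsCoprime (t.den : ℤ) t.num := by
      rw [Int.isCoprime_iff_nat_coprime]
      exact t.reduced.symm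
    obtain ⟨A, B, h⟩ := h1
    exact ⟨A + B * a, -B, by linear_combination h⟩
  have e : cuspSeq a (n + 1) = ((t.den : ℤ) : ℚ) / (((a : ℤ) * t.den - t.num : ℤ) : ℚ) := by
    rw [cuspSeq_recursion ha hn, ← ht]
    have hdq : (t.den : ℚ) ≠ 0 := by exact_mod_cast hd.ne'
    have htq : (a : ℚ) - t = (a * t.den - t.num) / t.den := by
      rw [sub_div, mul_div_cancel_right₀ _ hdq, Rat.num_div_den]
    rw [htq, one_div_div]
    push_cast
    rfl
  rw [e]
  exact ⟨Rat.num_div_eq_of_coprime hpos hcop, Rat.den_div_eq_of_coprime hpos hcop⟩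

theorem cuspSeq_den_lt {a n : ℕ} (ha : 3 ≤ a) (hn : 1 ≤ n) :
    (cuspSeq a n).den < (cuspSeq a (n + 1)).den := by
  have h := (cuspSeq_num_den_succ ha hn).1
  have h2 := cuspSeq_lt_one ha (n := n + 1) (by omega)
  rw [Rat.lt_iff, Rat.num_one, Rat.den_one, Nat.cast_one, mul_one, one_mul, h] at h2
  exact_mod_cast h2

theorem tendsto_cuspSeq_den {a : ℕ} (ha : 3 ≤ a) :
    Tendsto (fun n => (cuspSeq a n).den) atTop atTop := by
  rw [← tendsto_add_atTop_iff_nat 1]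
  exact (strictMono_nat_of_lt_succ fun n => cuspSeq_den_lt ha (by omega)).tendsto_atTop

theorem cuspSeq_succ_eq_den_div {a n : ℕ} (ha : 3 ≤ a) (hn : 1 ≤ n) :
    ((cuspSeq a (n + 1) : ℚ) : ℝ) = (cuspSeq a n).den / (cuspSeq a (n + 1)).den := by
  rw [Rat.cast_def, (cuspSeq_num_den_succ ha hn).1]
  simp

theorem cuspSeq_eq_sub {a n : ℕ} (ha : 3 ≤ a) (hn : 1 ≤ n) :
    ((cuspSeq a n : ℚ) : ℝ) = a - (cuspSeq a (n + 1)).den / (cuspSeq a n).den := by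
  have hd : ((cuspSeq a n).den : ℝ) ≠ 0 := by exact_mod_cast (cuspSeq a n).den_pos.ne'
  have h : ((cuspSeq a (n + 1)).den : ℝ) = a * (cuspSeq a n).den - (cuspSeq a n).num := by
    exact_mod_cast congrArg (Int.cast : ℤ → ℝ) (cuspSeq_num_den_succ ha hn).2
  rw [h, sub_div, mul_div_cancel_right₀ _ hd, Rat.cast_def]
  ring

theorem coprime_cuspSeq_den {a n : ℕ} (ha : 3 ≤ a) (hn : 1 ≤ n) :
    Nat.Coprime (cuspSeq a n).den (cuspSeq a (n + 1)).den := by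
  have h := (cuspSeq a (n + 1)).reduced
  rwa [(cuspSeq_num_den_succ ha hn).1, Int.natAbs_natCast] at h

/-- The fixed-point equation gives 1/(a − t) − ω = ω(t − ω)/(a − t). For t < 1 one has a − t > 1, so
each step contracts the distance to ω by at least the factor ω. -/
theorem tendsto_cuspSeq {a : ℕ} (ha : 3 ≤ a) {ω : ℝ} (h0 : 0 < ω) (h1 : ω < 1)
    (hω : ω * (a - ω) = 1) : Tendsto (fun n => ((cuspSeq a n : ℚ) : ℝ)) atTop (𝓝 ω) := by
  have key : ∀ n : ℕ, |((cuspSeq a (n + 1) : ℚ) : ℝ) - ω| ≤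
      ω ^ n * |((cuspSeq a 1 : ℚ) : ℝ) - ω| := by
    intro n
    induction n with
    | zero => simp
    | succ n ih =>
      have hlt : ((cuspSeq a (n + 1) : ℚ) : ℝ) < 1 := by
        exact_mod_cast cuspSeq_lt_one ha (n := n + 1) (by omega)
      have ha' : (3 : ℝ) ≤ a := by exact_mod_cast ha
      rw [cuspSeq_recursion ha (by omega : 1 ≤ n + 1)]
      push_cast
      have hpos : 1 < a - ((cuspSeq a (n + 1) : ℚ) : ℝ) := by linarith
      have e : 1 / (a - ((cuspSeq a (n + 1) : ℚ) : ℝ)) - ω =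
          ω * (((cuspSeq a (n + 1) : ℚ) : ℝ) - ω) / (a - ((cuspSeq a (n + 1) : ℚ) : ℝ)) := by
        rw [eq_div_iff (by linarith), sub_mul, one_div_mul_cancel (by linarith)]
        linear_combination -hω
      rw [e, abs_div, abs_mul, abs_of_pos h0, abs_of_pos (zero_lt_one.trans hpos), pow_succ]
      refine (div_le_self (by positivity) hpos.le).trans ?_
      calc _ ≤ ω * (ω ^ n * |((cuspSeq a 1 : ℚ) : ℝ) - ω|) := by gcongr
        _ = _ := by ring
  rw [← tendsto_add_atTop_iff_nat 1, tendsto_iff_norm_sub_tendsto_zero]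
  refine squeeze_zero (fun _ => norm_nonneg _) key ?_
  simpa using (tendsto_pow_atTop_nhds_zero_of_lt_one h0.le h1).mul_const _

/-! ### Absolute values of the cyclic quantum dilogarithm -/

theorem norm_cyclicDilog (t x y : ℚ) : ‖cyclicDilog t x y‖ =
    ∏ k ∈ Finset.range (t.den - 1),
      |2 * Real.sin (Real.pi * ((x * t + y : ℝ) + ((k + 1 : ℕ) : ℝ) * t))| ^
        (((k + 1 : ℕ) : ℝ) / t.den) := by
  have hI : Finset.Icc 1 (t.den - 1) = (Finset.range (t.den - 1)).image (· + 1) := by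
    ext k
    simp only [Finset.mem_Icc, Finset.mem_image, Finset.mem_range]
    exact ⟨fun h => ⟨k - 1, by omega, by omega⟩, by rintro ⟨j, h, rfl⟩; omega⟩
  rw [cyclicDilog, hI, Finset.prod_image (by simp), norm_prod]
  refine Finset.prod_congr rfl fun k _ => ?_
  rw [show (((k + 1 : ℕ) : ℂ) / (t.den : ℂ)) = ((((k + 1 : ℕ) : ℝ) / (t.den : ℝ) : ℝ) : ℂ) by
    push_cast; rfl, Complex.norm_cpow_real, ← norm_one_sub_exp]
  congr 4
  push_cast
  ring

theorem fract_add_mul_ne_zero {t : ℚ} {z : ℝ} (hz : Int.fract ((t.den : ℝ) * z) ≠ 0) (k : ℕ) :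
    Int.fract (z + k * t) ≠ 0 := by
  refine fract_ne_zero_of_natCast_mul (n := t.den) ?_
  have hd : (t.den : ℝ) ≠ 0 := by exact_mod_cast t.den_pos.ne'
  have e : (t.den : ℝ) * (z + k * t) = t.den * z + ((k * t.num : ℤ) : ℝ) := by
    rw [Rat.cast_def]
    push_cast
    field_simp
  rwa [e, Int.fract_add_intCast]

theorem norm_cyclicDilog_eq_exp {t x y : ℚ}
    (h : Int.fract ((t.den : ℝ) * (x * t + y)) ≠ 0) :
    ‖cyclicDilog t x y‖ = Real.exp (weightedLogSine t.den t (x * t + y)) := by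
  obtain ⟨d, hd⟩ := Nat.exists_eq_succ_of_ne_zero t.den_pos.ne'
  rw [norm_cyclicDilog, weightedLogSine, show Finset.range t.den = Finset.range (t.den - 1 + 1) by
    rw [hd]; rfl, Finset.sum_range_succ', Nat.cast_zero, zero_div, zero_mul, add_zero,
    Real.exp_sum]
  refine Finset.prod_congr rfl fun k _ => ?_
  have hs := sin_pi_mul_ne_zero (fract_add_mul_ne_zero h (k + 1))
  rw [Real.rpow_def_of_pos (abs_pos.2 (mul_ne_zero two_ne_zero hs)), logTwoSin, mul_comm]

/-- With z = c / t.den and c an integer, the congruence c + k · t.num ≡ 0 modulo t.den has a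
solution k, and the corresponding factor vanishes. -/
theorem cyclicDilog_eq_zero {t x y : ℚ} (h : Int.fract ((t.den : ℝ) * (x * t + y)) = 0)
    (h' : Int.fract ((x * t + y : ℝ)) ≠ 0) : cyclicDilog t x y = 0 := by
  obtain ⟨c, hc⟩ := Int.fract_eq_zero_iff.1 h
  have hdz : (t.den : ℤ) ≠ 0 := by exact_mod_cast t.den_pos.ne'
  have hd : (t.den : ℝ) ≠ 0 := by exact_mod_cast t.den_pos.ne'
  obtain ⟨A, B, hAB⟩ : IsCoprime t.num (t.den : ℤ) := by
    rw [Int.isCoprime_iff_nat_coprime]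
    exact t.reduced
  obtain ⟨k, hk⟩ := Int.eq_ofNat_of_zero_le (Int.emod_nonneg (-c * A) hdz)
  have hkd := Int.emod_lt_of_pos (-c * A) (show (0 : ℤ) < t.den by exact_mod_cast t.den_pos)
  have hdiv := Int.mul_ediv_add_emod (-c * A) t.den
  set e := (-c * A) / (t.den : ℤ)
  have hint : (x * t + y : ℝ) + k * t = ((c * B - e * t.num : ℤ) : ℝ) := by
    have h1 : (x * t + y : ℝ) = c / t.den := by rw [hc]; field_simp
    have h2 : (c : ℤ) + k * t.num = t.den * (c * B - e * t.num) := by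
      rw [hk] at hdiv
      linear_combination t.num * hdiv - c * hAB
    rw [h1, Rat.cast_def t, ← mul_div_assoc, ← add_div, div_eq_iff hd]
    have h3 := congrArg (Int.cast : ℤ → ℝ) h2
    push_cast at h3 ⊢
    linarith
  -- The product omits k = 0; that solution would force z itself to be an integer.
  have hk0 : k ≠ 0 := by
    rintro rfl
    apply h'
    rw [Nat.cast_zero, zero_mul, add_zero] at hint
    rw [hint, Int.fract_intCast]
  rw [← norm_eq_zero, norm_cyclicDilog]
  refine Finset.prod_eq_zero (i := k - 1) (Finset.mem_range.2 (by omega)) ?_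
  rw [Nat.sub_add_cancel (by omega : 1 ≤ k), hint, mul_comm Real.pi, Real.sin_int_mul_pi, mul_zero,
    abs_zero, Real.zero_rpow]
  exact div_ne_zero (Nat.cast_ne_zero.2 hk0) hd

/-- Reversing the order k ↦ den − k preserves |1 − ζ^k| and replaces the exponent k/den by 1 −
k/den. The square is thus ∏ |1 − ζ^k| = den, with ζ a primitive root of unity of order den. -/
theorem norm_cyclicDilog_zero_one {t : ℚ} : ‖cyclicDilog t 0 1‖ = √t.den := by
  obtain ⟨d, hd⟩ := Nat.exists_eq_succ_of_ne_zero t.den_pos.ne'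
  rw [Nat.succ_eq_add_one] at hd
  have hd' : (d : ℝ) + 1 ≠ 0 := by positivity
  set h : ℕ → ℝ := fun k => |2 * Real.sin (Real.pi * ((k + 1 : ℕ) * t))| with hh
  have hprod : ∏ k ∈ Finset.range d, h k = d + 1 := by
    have hcop : IsPrimitiveRoot (Complex.exp (2 * Real.pi * Complex.I * (t : ℂ))) (d + 1) := by
      rw [← hd]
      exact Complex.isPrimitiveRoot_exp_rat t
    have h1 := congrArg norm (IsPrimitiveRoot.prod_one_sub_pow_eq_order hcop)
    rw [norm_prod] at h1
    have h2 : ‖(d : ℂ) + 1‖ = d + 1 := by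
      rw [← Nat.cast_succ, Complex.norm_natCast]; push_cast; rfl
    rw [← h2, ← h1]
    refine Finset.prod_congr rfl fun k _ => ?_
    rw [hh, ← Complex.exp_nat_mul]
    beta_reduce
    rw [← norm_one_sub_exp]
    congr 3
    push_cast
    ring
  have hP : ‖cyclicDilog t 0 1‖ = ∏ k ∈ Finset.range d, h k ^ (((k : ℝ) + 1) / (d + 1)) := by
    rw [norm_cyclicDilog, hd, Nat.add_sub_cancel]
    refine Finset.prod_congr rfl fun k _ => ?_
    push_cast
    rw [hh, zero_mul, zero_add, mul_add, mul_one, add_comm, Real.sin_add_pi, mul_neg, abs_neg]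
    push_cast
    rfl
  have hrefl : ∏ k ∈ Finset.range d, h k ^ (((k : ℝ) + 1) / (d + 1)) =
      ∏ k ∈ Finset.range d, h k ^ (((d : ℝ) - k) / (d + 1)) := by
    rw [← Finset.prod_range_reflect]
    refine Finset.prod_congr rfl fun k hk => ?_
    have hkd := Finset.mem_range.1 hk
    have hcast : ((d - 1 - k : ℕ) : ℝ) = d - 1 - k := by
      rw [Nat.cast_sub (by omega), Nat.cast_sub (by omega), Nat.cast_one]
    have hsym : h (d - 1 - k) = h k := by
      rw [hh]
      simp only
      have e : Real.pi * (((d - 1 - k + 1 : ℕ) : ℝ) * t) =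
          (t.num : ℝ) * Real.pi - Real.pi * (((k + 1 : ℕ) : ℝ) * t) := by
        rw [Rat.cast_def, hd]
        push_cast
        rw [hcast]
        field_simp
        ring
      rw [e, Real.sin_int_mul_pi_sub, abs_mul, abs_mul, abs_neg, abs_mul, abs_zpow]
      simp
    rw [hsym, hcast]
    congr 2
    ring
  have hsq : ‖cyclicDilog t 0 1‖ ^ 2 = t.den := by
    rw [sq]
    nth_rw 2 [hP]
    rw [hP.trans hrefl, ← Finset.prod_mul_distrib, hd]
    rw [Nat.cast_add_one]
    refine Eq.trans (Finset.prod_congr rfl fun k hk => ?_) hprod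
    have hpos : h k ≠ 0 := by
      rw [← hprod, Finset.prod_ne_zero_iff] at hd'
      exact hd' k hk
    have hpos' : 0 < h k := lt_of_le_of_ne (abs_nonneg _) hpos.symm
    rw [← Real.rpow_add hpos', ← add_div, show (d : ℝ) - k + (k + 1) = d + 1 by ring,
      div_self hd', Real.rpow_one]
  rw [← hsq, Real.sqrt_sq (norm_nonneg _)]

/-! ### Passage to the limit and telescoping -/

/-- The limit of the reciprocity law along rational numbers converging to `ω`. -/
theorem tendsto_weightedLogSine_sub {m n : ℕ → ℕ} (hm : ∀ᶠ k in atTop, 0 < m k)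
    (hn : ∀ᶠ k in atTop, 0 < n k) (hmn : ∀ᶠ k in atTop, Nat.Coprime (m k) (n k))
    (hm' : Tendsto m atTop atTop) {ω : ℝ} (hω : 0 < ω)
    (hlim : Tendsto (fun k => (m k : ℝ) / n k) atTop (𝓝 ω)) (a : ℤ) {p q : ℚ}
    (h0 : 0 < (p : ℝ) * ω + q) (h1 : (p : ℝ) * ω + q < 1 + ω) :
    Tendsto (fun k =>
      weightedLogSine (m k) (a - n k / m k)
        (n k * (p * (m k / n k) + q) / m k + (a - n k / m k)) -
      weightedLogSine (n k) (m k / n k) (p * (m k / n k) + q))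
      (atTop ⊓ 𝓟 {k | Int.fract ((n k : ℝ) * (p * (m k / n k) + q)) ≠ 0})
      (𝓝 (logSineIntegral ω 1 (2 * (p * ω + q) - ω - 1))) := by
  set z : ℕ → ℝ := fun k => p * (m k / n k) + q with hz
  have hzlim : Tendsto z atTop (𝓝 (p * ω + q)) := (hlim.const_mul _).add_const _
  obtain ⟨B, hB, hBf⟩ := exists_bound_periodic periodic_logTwoSin (q := p.den * q.den)
    (Nat.mul_pos p.den_pos q.den_pos)
  obtain ⟨B', hB', hBf'⟩ := exists_bound_periodic periodic_clausen (q := p.den * q.den)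
    (Nat.mul_pos p.den_pos q.den_pos)
  -- Here n z = p m + q n, so its denominator divides `p.den * q.den` for every k. This keeps the
  -- periodic terms bounded although they may be unbounded on ℝ.
  have hint : ∀ k, 0 < n k → ∃ c : ℤ, ((p.den * q.den : ℕ) : ℝ) * (n k * z k) = c := by
    intro k hk
    refine ⟨p.num * q.den * m k + q.num * p.den * n k, ?_⟩
    have hk' : (n k : ℝ) ≠ 0 := Nat.cast_ne_zero.2 hk.ne'
    have hp : (p.den : ℝ) ≠ 0 := by exact_mod_cast p.den_pos.ne'
    have hq : (q.den : ℝ) ≠ 0 := by exact_mod_cast q.den_pos.ne'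
    rw [hz, Rat.cast_def p, Rat.cast_def q]
    push_cast
    field_simp
  have herr : Tendsto (fun k => ((1 - z k) * logTwoSin (n k * z k) +
      clausen (n k * z k) / n k) / m k) atTop (𝓝 0) := by
    have hb : Tendsto (fun k => (|1 - z k| * B + B') / (m k : ℝ)) atTop (𝓝 0) :=
      (((hzlim.const_sub 1).abs.mul_const B).add_const B').div_atTop
        (tendsto_natCast_atTop_atTop.comp hm')
    refine squeeze_zero_norm' ?_ hb
    filter_upwards [hn] with k hk
    have hk1 : (1 : ℝ) ≤ n k := by exact_mod_cast hk
    rw [norm_div, Real.norm_natCast]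
    gcongr
    refine (norm_add_le _ _).trans (add_le_add ?_ ?_)
    · rw [norm_mul, Real.norm_eq_abs, Real.norm_eq_abs]
      gcongr
      exact hBf _ (hint k hk)
    · rw [norm_div, Real.norm_natCast, Real.norm_eq_abs]
      exact (div_le_self (abs_nonneg _) hk1).trans (hBf' _ (hint k hk))
  have hmain : Tendsto (fun k => logSineIntegral (m k / n k) 1 (2 * z k - m k / n k - 1)) atTop
      (𝓝 (logSineIntegral ω 1 (2 * (p * ω + q) - ω - 1))) :=
    tendsto_logSineIntegral hω (by rw [abs_lt]; constructor <;> linarith) hlim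
      (((hzlim.const_mul 2).sub hlim).sub_const 1)
  have hsub := (hmain.sub herr).mono_left
    (inf_le_left (b := 𝓟 {k | Int.fract ((n k : ℝ) * z k) ≠ 0}))
  rw [sub_zero] at hsub
  refine hsub.congr' ?_
  have e0 : ∀ᶠ k in atTop, 0 < z k := hzlim.eventually (lt_mem_nhds h0)
  have e1 : ∀ᶠ k in atTop, z k < 1 + m k / n k :=
    hzlim.eventually_lt (hlim.const_add 1) h1
  rw [EventuallyEq, eventually_inf_principal]
  filter_upwards [hm, hn, hmn, e0, e1] with k k1 k2 k3 k4 k5 hk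
  rw [logSineIntegral_reciprocity k1 k2 k3 k4 k5 hk a]
  ring

/-- The condition that `x * t + y`, with `t` the `n`-th cusp, is not a multiple of `1 / t.den`. -/
def IsGeneric (a n : ℕ) (p q : ℚ) : Prop :=
  Int.fract (((cuspSeq a n).den : ℝ) * (p * (cuspSeq a n : ℚ) + q)) ≠ 0

/-- The two quantities den · (p t + q) differ by an integer. -/
theorem isGeneric_iff {a n : ℕ} (ha : 3 ≤ a) (hn : 1 ≤ n) {p q p' q' : ℚ} (hp : p' = 1 - q)
    {e : ℤ} (hq : q' = a * q + p + e) : IsGeneric a n p' q' ↔ IsGeneric a (n + 1) p q := by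
  unfold IsGeneric
  have hd : ((cuspSeq a n).den : ℝ) ≠ 0 := by exact_mod_cast (cuspSeq a n).den_pos.ne'
  have hd' : ((cuspSeq a (n + 1)).den : ℝ) ≠ 0 := by
    exact_mod_cast (cuspSeq a (n + 1)).den_pos.ne'
  have h : ((cuspSeq a n).den : ℝ) * (p' * (cuspSeq a n : ℚ) + q') =
      (cuspSeq a (n + 1)).den * (p * (cuspSeq a (n + 1) : ℚ) + q) +
      ((a * (cuspSeq a n).den - (cuspSeq a (n + 1)).den + e * (cuspSeq a n).den : ℤ) : ℝ) := by
    rw [cuspSeq_eq_sub ha hn, cuspSeq_succ_eq_den_div ha hn, hp, hq]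
    push_cast
    field_simp
    ring
  rw [h, Int.fract_add_intCast]

/-- One step of the limit formula. -/
theorem tendsto_norm_cyclicDilog_div {a : ℕ} (ha : 3 ≤ a) {ω : ℝ} (hω0 : 0 < ω) (hω1 : ω < 1)
    (hω : ω * (a - ω) = 1) {p q p' q' : ℚ} (hp : p' = 1 - q) {e : ℤ} (hq : q' = a * q + p + e)
    (h0 : 0 < (p : ℝ) * ω + q) (h1 : (p : ℝ) * ω + q < 1 + ω) :
    Tendsto (fun n => ‖cyclicDilog (cuspSeq a n) p' q'‖ / ‖cyclicDilog (cuspSeq a (n + 1)) p q‖)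
      (atTop ⊓ 𝓟 {n | IsGeneric a (n + 1) p q}) (𝓝 (doubleSine ω (p * ω + q))) := by
  have hlim : Tendsto (fun n => ((cuspSeq a n).den : ℝ) / (cuspSeq a (n + 1)).den) atTop (𝓝 ω) := by
    refine ((tendsto_add_atTop_iff_nat 1).2 (tendsto_cuspSeq ha hω0 hω1 hω)).congr' ?_
    filter_upwards [eventually_ge_atTop 1] with n hn
    exact cuspSeq_succ_eq_den_div ha hn
  have key := tendsto_weightedLogSine_sub (m := fun n => (cuspSeq a n).den)
    (n := fun n => (cuspSeq a (n + 1)).den) (Eventually.of_forall fun n => (cuspSeq a n).den_pos)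
    (Eventually.of_forall fun n => (cuspSeq a (n + 1)).den_pos)
    (by
      filter_upwards [eventually_ge_atTop 1] with n hn
      exact coprime_cuspSeq_den ha hn)
    (tendsto_cuspSeq_den ha) hω0 hlim a h0 h1
  have key2 := (Real.continuous_exp.tendsto _).comp key
  rw [← doubleSine_eq_exp] at key2
  have hset : (atTop ⊓ 𝓟 {n | IsGeneric a (n + 1) p q} : Filter ℕ) ≤
      atTop ⊓ 𝓟 {n | Int.fract (((cuspSeq a (n + 1)).den : ℝ) *
        (p * ((cuspSeq a n).den / (cuspSeq a (n + 1)).den) + q)) ≠ 0} := by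
    refine le_inf inf_le_left ?_
    rw [le_principal_iff, mem_inf_principal]
    filter_upwards [eventually_ge_atTop 1] with n hn h
    rw [IsGeneric, cuspSeq_succ_eq_den_div ha hn] at h
    exact h
  refine (key2.mono_left hset).congr' ?_
  rw [EventuallyEq, eventually_inf_principal]
  filter_upwards [eventually_ge_atTop 1] with n hn hgen
  have hgen' := (isGeneric_iff ha hn hp hq).2 hgen
  rw [norm_cyclicDilog_eq_exp hgen, norm_cyclicDilog_eq_exp hgen', ← Real.exp_sub,
    Function.comp_apply]
  congr 1
  have hd : ((cuspSeq a n).den : ℝ) ≠ 0 := by exact_mod_cast (cuspSeq a n).den_pos.ne'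
  have hd' : ((cuspSeq a (n + 1)).den : ℝ) ≠ 0 := by
    exact_mod_cast (cuspSeq a (n + 1)).den_pos.ne'
  -- With n/m = a − t, the point n z/m + (a − n/m) equals p + q(a − t) + t = (1 − q)t + (aq + p).
  -- This dictates the form of p' and q'.
  have harg : ((cuspSeq a (n + 1)).den : ℝ) *
      (p * ((cuspSeq a n).den / (cuspSeq a (n + 1)).den) + q) / (cuspSeq a n).den +
      (((a : ℤ) : ℝ) - (cuspSeq a (n + 1)).den / (cuspSeq a n).den) =
      p' * (cuspSeq a n : ℚ) + q' - e * 1 := by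
    rw [cuspSeq_eq_sub ha hn, hp, hq]
    push_cast
    field_simp
    ring
  have hper : ∀ (N : ℕ) (t w : ℝ), weightedLogSine N t (w - e * 1) = weightedLogSine N t w := by
    intro N t w
    unfold weightedLogSine
    refine Finset.sum_congr rfl fun k _ => ?_
    rw [sub_add_eq_add_sub, periodic_logTwoSin.sub_int_mul_eq]
  rw [harg, hper, Int.cast_natCast, ← cuspSeq_eq_sub ha hn, ← cuspSeq_succ_eq_den_div ha hn]

theorem IsGeneric.norm_cyclicDilog_ne_zero {a n : ℕ} {p q : ℚ} (h : IsGeneric a n p q) :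
    ‖cyclicDilog (cuspSeq a n) p q‖ ≠ 0 := by
  rw [norm_cyclicDilog_eq_exp h]
  exact (Real.exp_pos _).ne'

theorem isGeneric_iff_iterate {a : ℕ} (ha : 3 ≤ a) {p q : ℕ → ℚ} (g : ℕ)
    (hp : ∀ l < g, p (l + 1) = 1 - q l) (hq : ∀ l < g, ∃ e : ℤ, q (l + 1) = a * q l + p l + e)
    {n : ℕ} (hn : 1 ≤ n) : IsGeneric a n (p g) (q g) ↔ IsGeneric a (n + g) (p 0) (q 0) := by
  induction g generalizing n with
  | zero => rfl
  | succ g ih =>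
    obtain ⟨e, he⟩ := hq g g.lt_succ_self
    rw [isGeneric_iff ha hn (hp g g.lt_succ_self) he,
      ih (fun l hl => hp l (hl.trans g.lt_succ_self)) (fun l hl => hq l (hl.trans g.lt_succ_self))
        (by omega), add_right_comm, add_assoc]

/-- The limit formula along a chain of pairs. -/
theorem tendsto_norm_cyclicDilog_chain {a : ℕ} (ha : 3 ≤ a) {ω : ℝ} (hω0 : 0 < ω) (hω1 : ω < 1)
    (hω : ω * (a - ω) = 1) {p q : ℕ → ℚ} (g : ℕ)
    (hp : ∀ l < g, p (l + 1) = 1 - q l) (hq : ∀ l < g, ∃ e : ℤ, q (l + 1) = a * q l + p l + e)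
    (h0 : ∀ l < g, 0 < (p l : ℝ) * ω + q l) (h1 : ∀ l < g, (p l : ℝ) * ω + q l < 1 + ω) :
    Tendsto (fun n => ‖cyclicDilog (cuspSeq a n) (p g) (q g)‖ /
        ‖cyclicDilog (cuspSeq a (n + g)) (p 0) (q 0)‖)
      (atTop ⊓ 𝓟 {n | IsGeneric a (n + g) (p 0) (q 0)})
      (𝓝 (∏ l ∈ Finset.range g, doubleSine ω (p l * ω + q l))) := by
  induction g with
  | zero =>
    rw [Finset.prod_range_zero]
    refine tendsto_const_nhds.congr' ?_
    rw [EventuallyEq, eventually_inf_principal]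
    exact Eventually.of_forall fun n hn => (div_self (IsGeneric.norm_cyclicDilog_ne_zero hn)).symm
  | succ g ih =>
    have hp' : ∀ l < g, p (l + 1) = 1 - q l := fun l hl => hp l (hl.trans g.lt_succ_self)
    have hq' : ∀ l < g, ∃ e : ℤ, q (l + 1) = a * q l + p l + e :=
      fun l hl => hq l (hl.trans g.lt_succ_self)
    have ih' := ih hp' hq' (fun l hl => h0 l (hl.trans g.lt_succ_self))
      (fun l hl => h1 l (hl.trans g.lt_succ_self))
    obtain ⟨e, he⟩ := hq g g.lt_succ_self
    have step := tendsto_norm_cyclicDilog_div ha hω0 hω1 hω (hp g g.lt_succ_self) he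
      (h0 g g.lt_succ_self) (h1 g g.lt_succ_self)
    have hgen : ∀ n, IsGeneric a (n + (g + 1)) (p 0) (q 0) → IsGeneric a (n + 1) (p g) (q g) := by
      intro n hn
      rw [isGeneric_iff_iterate ha g hp' hq' (by omega), add_right_comm, add_assoc]
      exact hn
    have step' := step.mono_left (y := atTop ⊓ 𝓟 {n | IsGeneric a (n + (g + 1)) (p 0) (q 0)})
      (inf_le_inf_left _ (principal_mono.2 hgen))
    -- The quotient for the first g steps is used at index n + 1, so that its numerator cancels the
    -- denominator of the last step.
    have hshift : Tendsto (fun n => n + 1) (atTop ⊓ 𝓟 {n | IsGeneric a (n + (g + 1)) (p 0) (q 0)})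
        (atTop ⊓ 𝓟 {n | IsGeneric a (n + g) (p 0) (q 0)}) := by
      refine tendsto_inf.2 ⟨(tendsto_add_atTop_nat 1).mono_left inf_le_left, ?_⟩
      rw [tendsto_principal, eventually_inf_principal]
      refine Eventually.of_forall fun n hn => ?_
      rw [Set.mem_ofPred, add_right_comm, add_assoc]
      exact hn
    have hmul := step'.mul (ih'.comp hshift)
    rw [mul_comm, ← Finset.prod_range_succ (fun l => doubleSine ω (p l * ω + q l))] at hmul
    refine hmul.congr' ?_
    rw [EventuallyEq, eventually_inf_principal]
    refine Eventually.of_forall fun n hn => ?_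
    rw [Function.comp_apply, div_mul_div_cancel₀ (hgen n hn).norm_cyclicDilog_ne_zero,
      add_right_comm, add_assoc]

/-- The complement of ℤ in ℝ is an open set containing x. -/
theorem eventually_fract_ne_zero {u : ℕ → ℝ} {x : ℝ} (hx : Irrational x)
    (hu : Tendsto u atTop (𝓝 x)) : ∀ᶠ n in atTop, Int.fract (u n) ≠ 0 := by
  have hopen : IsOpen (Set.range ((↑) : ℤ → ℝ))ᶜ :=
    Int.isClosedEmbedding_coe_real.isClosed_range.isOpen_compl
  have hmem : x ∈ (Set.range ((↑) : ℤ → ℝ))ᶜ := by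
    rintro ⟨k, rfl⟩
    exact hx ⟨k, by simp⟩
  filter_upwards [hu.eventually (hopen.mem_nhds hmem)] with n hn h
  exact hn (Int.fract_eq_zero_iff.1 h)

/-- Eventually, `D_t(p, q) ≠ 0` only for generic parameters. -/
theorem eventually_isGeneric {a : ℕ} (ha : 3 ≤ a) {ω : ℝ} (hω0 : 0 < ω) (hω1 : ω < 1)
    (hω : ω * (a - ω) = 1) (hirr : Irrational ω) {p q : ℚ} (hpq : p ≠ 0 ∨ Int.fract q ≠ 0) :
    ∀ᶠ n in atTop, cyclicDilog (cuspSeq a n) p q ≠ 0 → IsGeneric a n p q := by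
  have hfr : ∀ᶠ n in atTop, Int.fract ((p : ℝ) * (cuspSeq a n : ℚ) + q) ≠ 0 := by
    by_cases hp : p = 0
    · have hq : Int.fract q ≠ 0 := by tauto
      refine Eventually.of_forall fun n h => hq ?_
      rw [hp, Rat.cast_zero, zero_mul, zero_add] at h
      exact_mod_cast h
    · refine eventually_fract_ne_zero ((hirr.ratCast_mul hp).add_ratCast q) ?_
      exact ((tendsto_cuspSeq ha hω0 hω1 hω).const_mul _).add_const _
  filter_upwards [hfr] with n hn hne hgen
  exact hne (cyclicDilog_eq_zero hgen hn)

/-! ### The normalized orbit and the two limit formulas -/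

theorem fractOne_pos (q : ℚ) : 0 < fractOne q := by
  unfold fractOne
  split_ifs with h
  · exact one_pos
  · exact lt_of_le_of_ne (Int.fract_nonneg q) (Ne.symm h)

theorem fractOne_le_one (q : ℚ) : fractOne q ≤ 1 := by
  unfold fractOne
  split_ifs with h
  · exact le_rfl
  · exact (Int.fract_lt_one q).le

theorem exists_fractOne_eq_add (q : ℚ) : ∃ e : ℤ, fractOne q = q + e := by
  unfold fractOne
  split_ifs with h
  · obtain ⟨k, rfl⟩ := Int.fract_eq_zero_iff.1 h
    exact ⟨1 - k, by push_cast; ring⟩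
  · exact ⟨-⌊q⌋, by rw [← Int.self_sub_floor]; push_cast; ring⟩

theorem orbitStep_fst (a : ℕ) (p : ℚ × ℚ) : (orbitStep a p).1 = fractOne (a * p.1 + p.2) := by
  simp [orbitStep, shintaniMatrix, mul_comm]

theorem orbitStep_snd (a : ℕ) (p : ℚ × ℚ) : (orbitStep a p).2 = Int.fract (-p.1) := by
  simp [orbitStep, shintaniMatrix]

/-- The fundamental domain `(0, 1] × [0, 1)` for the translations of `ℚ × ℚ` by `ℤ × ℤ`. -/
def unitDomain : Set (ℚ × ℚ) := {p | 0 < p.1 ∧ p.1 ≤ 1 ∧ 0 ≤ p.2 ∧ p.2 < 1}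

theorem orbitStep_mem (a : ℕ) (p : ℚ × ℚ) : orbitStep a p ∈ unitDomain := by
  unfold unitDomain
  rw [Set.mem_ofPred, orbitStep_fst, orbitStep_snd]
  exact ⟨fractOne_pos _, fractOne_le_one _, Int.fract_nonneg _, Int.fract_lt_one _⟩

theorem iterate_orbitStep_mem (a : ℕ) {p : ℚ × ℚ} (hp : p ∈ unitDomain) (l : ℕ) :
    (orbitStep a)^[l] p ∈ unitDomain := by
  cases l with
  | zero => exact hp
  | succ l =>
    rw [Function.iterate_succ_apply']
    exact orbitStep_mem a _

theorem orbitStep_snd_eq_one_sub (a : ℕ) {p : ℚ × ℚ} (hp : p ∈ unitDomain) :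
    (orbitStep a p).2 = 1 - p.1 := by
  rw [orbitStep_snd, ← Int.fract_add_one, Int.fract_eq_iff]
  exact ⟨by linarith [hp.2.1], by linarith [hp.1], 0, by push_cast; ring⟩

/-- The limit formula for the product of double sine values attached to `ε`. -/
theorem tendsto_cyclicDilog_swap {a : ℕ} (ha : 3 ≤ a) {ω : ℝ} (hω0 : 0 < ω) (hω1 : ω < 1)
    (hω : ω * (a - ω) = 1) (hirr : Irrational ω) {p : ℚ × ℚ} (hp : p ∈ unitDomain) {g : ℕ}
    (horbit : (orbitStep a)^[g] p = p) :
    Tendsto (fun n => ‖cyclicDilog (cuspSeq a n) p.2 p.1 / cyclicDilog (cuspSeq a (n + g)) p.2 p.1‖)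
      (atTop ⊓ 𝓟 {n | cyclicDilog (cuspSeq a (n + g)) p.2 p.1 ≠ 0})
      (𝓝 (shintaniProduct a g p ω⁻¹)) := by
  -- Inverting the period exchanges the two coordinates, so the orbit of (x, y) is read as the chain
  -- (p, q) = (y, x) with period ω.
  have hS : ∀ r : ℚ × ℚ, doubleSine ω⁻¹ (r.1 * ω⁻¹ + r.2) = doubleSine ω (r.2 * ω + r.1) := by
    intro r
    rw [doubleSine_inv (inv_pos.2 hω0), inv_inv]
    congr 1
    field_simp
    ring
  simp_rw [norm_div, shintaniProduct, hS]
  by_cases hgen : p.2 ≠ 0 ∨ Int.fract p.1 ≠ 0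
  · have hchain := tendsto_norm_cyclicDilog_chain ha hω0 hω1 hω
      (p := fun l => ((orbitStep a)^[l] p).2) (q := fun l => ((orbitStep a)^[l] p).1) g
      (fun l _ => by
        rw [Function.iterate_succ_apply']
        exact orbitStep_snd_eq_one_sub a (iterate_orbitStep_mem a hp l))
      (fun l _ => by
        rw [Function.iterate_succ_apply', orbitStep_fst]
        exact exists_fractOne_eq_add _)
      (fun l _ => by
        have h := iterate_orbitStep_mem a hp l
        have h1 : (0 : ℝ) < ((orbitStep a)^[l] p).1 := by exact_mod_cast h.1
        have h2 : (0 : ℝ) ≤ ((orbitStep a)^[l] p).2 := by exact_mod_cast h.2.2.1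
        positivity)
      (fun l _ => by
        have h := iterate_orbitStep_mem a hp l
        have h1 : (((orbitStep a)^[l] p).1 : ℝ) ≤ 1 := by exact_mod_cast h.2.1
        have h2 : (((orbitStep a)^[l] p).2 : ℝ) < 1 := by exact_mod_cast h.2.2.2
        nlinarith)
    simp only [horbit, Function.iterate_zero, id_eq] at hchain
    refine hchain.mono_left (le_inf inf_le_left ?_)
    rw [le_principal_iff, mem_inf_principal]
    exact (tendsto_add_atTop_nat g).eventually (eventually_isGeneric ha hω0 hω1 hω hirr hgen)
  · obtain ⟨h2, h1⟩ : p.2 = 0 ∧ Int.fract p.1 = 0 := by tauto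
    have hp1 : p.1 = 1 := by
      obtain ⟨k, hk⟩ := Int.fract_eq_zero_iff.1 h1
      have h3 := hp.1
      have h4 := hp.2.1
      rw [← hk] at h3 h4 ⊢
      norm_cast at h3 h4 ⊢
      omega
    have hfix : orbitStep a p = p := by
      refine Prod.ext ?_ ?_
      · rw [orbitStep_fst, hp1, h2, fractOne, if_pos]
        rw [mul_one, add_zero, Int.fract_natCast]
      · rw [orbitStep_snd_eq_one_sub a hp, hp1, h2, sub_self]
    simp_rw [Function.iterate_fixed hfix, hp1, h2, Rat.cast_zero, Rat.cast_one, zero_mul, zero_add,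
      norm_cyclicDilog_zero_one, doubleSine_one hω0, Finset.prod_const, Finset.card_range]
    refine Tendsto.mono_left ?_ inf_le_left
    have hstep : Tendsto (fun n => √((cuspSeq a n).den : ℝ) / √((cuspSeq a (n + 1)).den)) atTop
        (𝓝 √ω) := by
      have h := (tendsto_add_atTop_iff_nat 1).2 (tendsto_cuspSeq ha hω0 hω1 hω)
      refine ((Real.continuous_sqrt.tendsto _).comp h).congr' ?_
      filter_upwards [eventually_ge_atTop 1] with n hn
      rw [Function.comp_apply, cuspSeq_succ_eq_den_div ha hn, Real.sqrt_div (Nat.cast_nonneg _)]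
    have hne : ∀ n, √((cuspSeq a n).den : ℝ) ≠ 0 := fun n =>
      (Real.sqrt_pos.2 (Nat.cast_pos.2 (cuspSeq a n).den_pos)).ne'
    -- The pair being fixed, the formula holds for every g and can be proved by induction.
    clear horbit
    induction g with
    | zero => simp
    | succ g ih =>
      have := hstep.mul (ih.comp (tendsto_add_atTop_nat 1))
      rw [pow_succ']
      refine this.congr fun n => ?_
      rw [Function.comp_apply, div_mul_div_cancel₀ (hne _), add_right_comm, add_assoc]

/-- The limit formula for the product of double sine values attached to `ε'`. -/
theorem tendsto_cyclicDilog {a : ℕ} (ha : 3 ≤ a) {ω : ℝ} (hω0 : 0 < ω) (hω1 : ω < 1)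
    (hω : ω * (a - ω) = 1) (hirr : Irrational ω) {p : ℚ × ℚ} (hp : p ∈ unitDomain) {g : ℕ}
    (horbit : (orbitStep a)^[g] p = p) :
    Tendsto (fun n => ‖cyclicDilog (cuspSeq a n) p.1 p.2 / cyclicDilog (cuspSeq a (n + g)) p.1 p.2‖)
      (atTop ⊓ 𝓟 {n | cyclicDilog (cuspSeq a (n + g)) p.1 p.2 ≠ 0})
      (𝓝 (shintaniProduct a g p ω)) := by
  simp_rw [norm_div]
  have hsucc : ∀ l < g, g - l = (g - (l + 1)) + 1 := fun l hl => by omega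
  -- From y_{l+1} = 1 − x_l follow x_l = 1 − y_{l+1} and y_l ≡ a y_{l+1} + x_{l+1} modulo 1, so the
  -- orbit traversed backwards is a chain with (p, q) = (x, y).
  have hchain := tendsto_norm_cyclicDilog_chain ha hω0 hω1 hω
    (p := fun l => ((orbitStep a)^[g - l] p).1) (q := fun l => ((orbitStep a)^[g - l] p).2) g
    (fun l hl => by
      rw [hsucc l hl, Function.iterate_succ_apply',
        orbitStep_snd_eq_one_sub a (iterate_orbitStep_mem a hp _)]
      ring)
    (fun l hl => by
      rw [hsucc l hl, Function.iterate_succ_apply',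
        orbitStep_snd_eq_one_sub a (iterate_orbitStep_mem a hp _), orbitStep_fst]
      obtain ⟨e, he⟩ := exists_fractOne_eq_add
        (a * ((orbitStep a)^[g - (l + 1)] p).1 + ((orbitStep a)^[g - (l + 1)] p).2)
      exact ⟨-a - e, by rw [he]; push_cast; ring⟩)
    (fun l _ => by
      have h := iterate_orbitStep_mem a hp (g - l)
      have h1 : (0 : ℝ) < ((orbitStep a)^[g - l] p).1 := by exact_mod_cast h.1
      have h2 : (0 : ℝ) ≤ ((orbitStep a)^[g - l] p).2 := by exact_mod_cast h.2.2.1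
      positivity)
    (fun l _ => by
      have h := iterate_orbitStep_mem a hp (g - l)
      have h1 : (((orbitStep a)^[g - l] p).1 : ℝ) ≤ 1 := by exact_mod_cast h.2.1
      have h2 : (((orbitStep a)^[g - l] p).2 : ℝ) < 1 := by exact_mod_cast h.2.2.2
      nlinarith)
  have hprod : ∏ l ∈ Finset.range g, doubleSine ω
      (((orbitStep a)^[g - l] p).1 * ω + ((orbitStep a)^[g - l] p).2) = shintaniProduct a g p ω := by
    unfold shintaniProduct
    set F : ℕ → ℝ := fun l =>
      doubleSine ω (((orbitStep a)^[l] p).1 * ω + ((orbitStep a)^[l] p).2) with hF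
    -- The reversed chain multiplies the members with indices 1, …, g instead of 0, …, g − 1;
    -- closedness of the orbit makes the products equal.
    have hcyc : F g = F 0 := by
      rw [hF]
      simp only [horbit, Function.iterate_zero, id_eq]
    have hF0 : F 0 ≠ 0 := (Real.exp_pos _).ne'
    have h1 := Finset.prod_range_succ F g
    rw [Finset.prod_range_succ', hcyc] at h1
    rw [← mul_right_cancel₀ hF0 h1, ← Finset.prod_range_reflect]
    refine Finset.prod_congr rfl fun l hl => ?_
    rw [show g - (g - 1 - l) = l + 1 by have := Finset.mem_range.1 hl; omega]
  rw [hprod] at hchain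
  simp only [Nat.sub_self, Nat.sub_zero, horbit, Function.iterate_zero, id_eq] at hchain
  refine hchain.mono_left (le_inf inf_le_left ?_)
  rw [le_principal_iff, mem_inf_principal]
  exact (tendsto_add_atTop_nat g).eventually
    (eventually_isGeneric ha hω0 hω1 hω hirr (Or.inl hp.1.ne'))

/-! ### Totally positive units of the real quadratic field -/

theorem irrational_sqrt_of_not_isSquare {d : ℕ} (hd : ¬ IsSquare d) : Irrational √(d : ℝ) :=
  irrational_sqrt_natCast_iff.2 hd

/-- A field generated over `ℚ` by a square root `s` of `d` embeds into `ℝ` with `s ↦ r` for each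
real square root `r` of `d`. -/
theorem exists_ringHom_real {K : Type*} [Field K] [CharZero K] {d : ℕ} (hd : ¬ IsSquare d) {s : K}
    (hs : s ^ 2 = d) (hK : IntermediateField.adjoin ℚ {s} = ⊤) {r : ℝ} (hr : r ^ 2 = d) :
    ∃ σ : K →+* ℝ, σ s = r := by
  have hmonic : (Polynomial.X ^ 2 - Polynomial.C (d : ℚ)).Monic :=
    Polynomial.monic_X_pow_sub_C _ two_ne_zero
  have hirr : Irreducible (Polynomial.X ^ 2 - Polynomial.C (d : ℚ)) := by
    refine X_pow_sub_C_irreducible_of_prime Nat.prime_two fun b hb => ?_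
    have h1 : |(b : ℝ)| = √(d : ℝ) := by
      rw [← Real.sqrt_sq_eq_abs]
      congr 1
      exact_mod_cast hb
    refine irrational_sqrt_of_not_isSquare hd ⟨|b|, ?_⟩
    rw [← h1]
    push_cast
    rfl
  have hroot : Polynomial.aeval s (Polynomial.X ^ 2 - Polynomial.C (d : ℚ)) = 0 := by
    simp [hs]
  have hmin : minpoly ℚ s = Polynomial.X ^ 2 - Polynomial.C (d : ℚ) :=
    (minpoly.eq_of_irreducible_of_monic hirr hroot hmonic).symm
  have hint : IsIntegral ℚ s := ⟨_, hmonic, hroot⟩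
  have hmem : r ∈ (minpoly ℚ s).aroots ℝ := by
    rw [Polynomial.mem_aroots, hmin]
    exact ⟨hmonic.ne_zero, by simp [hr]⟩
  let φ := (IntermediateField.algHomAdjoinIntegralEquiv ℚ hint).symm ⟨r, hmem⟩
  let e : K ≃ₐ[ℚ] IntermediateField.adjoin ℚ {s} :=
    (IntermediateField.topEquiv.symm.trans (IntermediateField.equivOfEq hK.symm))
  refine ⟨(φ.comp e.toAlgHom).toRingHom, ?_⟩
  have he : e s = IntermediateField.AdjoinSimple.gen ℚ s := rfl
  have := IntermediateField.algHomAdjoinIntegralEquiv_symm_apply_gen ℚ hint ⟨r, hmem⟩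
  change φ (e s) = r
  rw [he]
  exact this

/-- The arithmetic of a generator `(a + b √d) / 2` of the group of totally positive units: it has
norm one, and `a ≥ 3`. -/
theorem generator_spec {K : Type*} [Field K] [NumberField K]
    {d : ℕ} (hd : ¬ IsSquare d) {s : 𝓞 K} (hs : s ^ 2 = (d : 𝓞 K))
    (hK : IntermediateField.adjoin ℚ {(s : K)} = ⊤) {a b : ℕ} {ε : (𝓞 K)ˣ}
    (hε : ((ε : 𝓞 K) : K) = ((a : K) + (b : K) * (s : K)) / 2)
    (hgen : Subgroup.zpowers ε = totallyPositiveUnits K) :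
    b ≠ 0 ∧ (a : ℝ) ^ 2 - d * (b : ℝ) ^ 2 = 4 ∧ 3 ≤ a := by
  have hd0 : d ≠ 0 := by rintro rfl; exact hd (IsSquare.zero)
  have hsK : (s : K) ^ 2 = d := by exact_mod_cast congrArg (algebraMap (𝓞 K) K) hs
  have hsq : √(d : ℝ) ^ 2 = d := Real.sq_sqrt (Nat.cast_nonneg d)
  obtain ⟨σ₁, h1⟩ := exists_ringHom_real hd hsK hK hsq
  obtain ⟨σ₂, h2⟩ := exists_ringHom_real hd hsK hK (r := -√(d : ℝ)) (by rw [neg_sq, hsq])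
  -- A nontrivial Pell solution yields a totally positive unit η with Y ≠ 0. Writing η = ε^k forces
  -- b ≠ 0 and k ≠ 0.
  obtain ⟨X, Y, hXY, hY⟩ := Pell.exists_of_not_isSquare (d := (d : ℤ))
    (by exact_mod_cast Nat.pos_of_ne_zero hd0) (by rwa [Int.isSquare_natCast_iff])
  have hX : X ≠ 0 := by
    rintro rfl
    nlinarith [sq_nonneg Y, Int.natCast_nonneg d]
  wlog hXpos : 0 < X generalizing X
  · exact this (-X) (by rwa [neg_sq]) (neg_ne_zero.2 hX) (by omega)
  have hXYK : (X : 𝓞 K) ^ 2 - d * (Y : 𝓞 K) ^ 2 = 1 := by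
    exact_mod_cast congrArg (Int.cast : ℤ → 𝓞 K) hXY
  let η : (𝓞 K)ˣ := ⟨X + Y * s, X - Y * s, by linear_combination hXYK - Y ^ 2 * hs,
    by linear_combination hXYK - Y ^ 2 * hs⟩
  have hσ : ∀ σ : K →+* ℝ, σ ((η : 𝓞 K) : K) = X + Y * σ (s : K) := by
    intro σ
    change σ ((X + Y * s : 𝓞 K) : K) = _
    simp
  have hXYR : (X : ℝ) ^ 2 - d * (Y : ℝ) ^ 2 = 1 := by exact_mod_cast hXY
  have hXR : (0 : ℝ) < X := by exact_mod_cast hXpos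
  have hη : η ∈ totallyPositiveUnits K := by
    intro σ
    rw [hσ]
    have h3 : σ (s : K) ^ 2 = d := by rw [← map_pow, hsK, map_natCast]
    -- The conjugates have product 1 and sum 2X > 0, so both are positive.
    have h4 : (X + Y * σ (s : K)) * (X - Y * σ (s : K)) = 1 := by
      linear_combination hXYR - (Y : ℝ) ^ 2 * h3
    by_contra hneg
    rw [not_lt] at hneg
    nlinarith
  rw [← hgen, Subgroup.mem_zpowers_iff] at hη
  obtain ⟨k, hk⟩ := hη
  have hεpos : ∀ σ : K →+* ℝ, 0 < σ ((ε : 𝓞 K) : K) := by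
    have : ε ∈ totallyPositiveUnits K := hgen ▸ Subgroup.mem_zpowers ε
    exact this
  have hpow : ∀ σ : K →+* ℝ, σ ((ε : 𝓞 K) : K) ^ k = X + Y * σ (s : K) := by
    intro σ
    rw [← hσ, ← hk, ← map_zpow₀]
    exact congrArg σ (NumberField.Units.coe_zpow ε k).symm
  have hσε : ∀ σ : K →+* ℝ, σ ((ε : 𝓞 K) : K) = (a + b * σ (s : K)) / 2 := by
    intro σ
    rw [hε, map_div₀, map_ofNat]
    simp
  have e1 := hpow σ₁
  have e2 := hpow σ₂
  have p1 := hεpos σ₁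
  have p2 := hεpos σ₂
  rw [hσε, h1] at e1 p1
  rw [hσε, h2] at e2 p2
  have hsd : 0 < √(d : ℝ) := Real.sqrt_pos.2 (Nat.cast_pos.2 (Nat.pos_of_ne_zero hd0))
  have hYR : (Y : ℝ) ≠ 0 := by exact_mod_cast hY
  have hb : b ≠ 0 := by
    rintro rfl
    simp only [Nat.cast_zero, zero_mul, add_zero] at e1 e2
    rw [e1] at e2
    have : (Y : ℝ) * √(d : ℝ) = 0 := by linarith
    exact (mul_ne_zero hYR hsd.ne') this
  have hnorm : (a : ℝ) ^ 2 - d * (b : ℝ) ^ 2 = 4 := by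
    -- The norm of ε is a positive real whose k-th power is the norm of η, namely 1; as k ≠ 0, it
    -- equals 1.
    have hmul : ((a + b * √(d : ℝ)) / 2 * ((a + b * -√(d : ℝ)) / 2)) ^ k = 1 := by
      rw [mul_zpow, e1, e2]
      linear_combination hXYR - (Y : ℝ) ^ 2 * hsq
    have hk0 : k ≠ 0 := by
      rintro rfl
      rw [zpow_zero] at e1 e2
      have : (Y : ℝ) * √(d : ℝ) = 0 := by linarith
      exact (mul_ne_zero hYR hsd.ne') this
    have hone := by_contra fun h => hk0 ((zpow_eq_one_iff_right₀ (mul_pos p1 p2).le h).1 hmul)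
    linear_combination 4 * hone + (b : ℝ) ^ 2 * hsq
  refine ⟨hb, hnorm, ?_⟩
  have hN : a ^ 2 = 4 + d * b ^ 2 := by
    have : (a : ℝ) ^ 2 = 4 + d * (b : ℝ) ^ 2 := by linarith
    exact_mod_cast this
  have : 0 < d * b ^ 2 := by positivity
  by_contra hlt
  have : a ≤ 2 := by omega
  nlinarith

end Shintani

end

/-! ### The limit formulas for X_1 and X_2 -/

theorem mainTheorem1
    (K : Type*) [Field K] [NumberField K]
    (d : ℕ) (hd : ¬ IsSquare d)
    (s : 𝓞 K) (hs : s ^ 2 = (d : 𝓞 K))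
    (hK : IntermediateField.adjoin ℚ {(s : K)} = ⊤)
    (a b : ℕ) (ε : (𝓞 K)ˣ)
    (hε : ((ε : 𝓞 K) : K) = ((a : K) + (b : K) * (s : K)) / 2)
    (hgen : Subgroup.zpowers ε = Shintani.totallyPositiveUnits K)
    (𝔣 : Ideal (𝓞 K)) (h𝔣 : 𝔣 ≠ ⊥)
    (u v : ℤ) (huv : 𝔣 = Ideal.span {(u : 𝓞 K) + (v : 𝓞 K) * s})
    (x y : ℚ) (hxy : (x, y) = Shintani.shintaniPair a b u v (Ideal.absNorm 𝔣))
    (g : ℕ) (hg : g = Shintani.conductorExponent ε 𝔣)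
    (horbit : (Shintani.orbitStep a)^[g] (x, y) = (x, y)) :
    Tendsto
      (fun n : ℕ => ‖Shintani.cyclicDilog (Shintani.cuspSeq a n) y x /
        Shintani.cyclicDilog (Shintani.cuspSeq a (n + g)) y x‖)
      (atTop ⊓ 𝓟 {n : ℕ | Shintani.cyclicDilog (Shintani.cuspSeq a (n + g)) y x ≠ 0})
      (𝓝 (Shintani.shintaniProduct a g (x, y) (((a : ℝ) + (b : ℝ) * Real.sqrt d) / 2))) ∧
    Tendsto
      (fun n : ℕ => ‖Shintani.cyclicDilog (Shintani.cuspSeq a n) x y /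
        Shintani.cyclicDilog (Shintani.cuspSeq a (n + g)) x y‖)
      (atTop ⊓ 𝓟 {n : ℕ | Shintani.cyclicDilog (Shintani.cuspSeq a (n + g)) x y ≠ 0})
      (𝓝 (Shintani.shintaniProduct a g (x, y) (((a : ℝ) - (b : ℝ) * Real.sqrt d) / 2))) := by
  obtain ⟨hb, hnorm, ha⟩ := Shintani.generator_spec hd hs hK hε hgen
  have hsq : √(d : ℝ) ^ 2 = d := Real.sq_sqrt (Nat.cast_nonneg d)
  have hbR : (0 : ℝ) < b := Nat.cast_pos.2 (Nat.pos_of_ne_zero hb)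
  have haR : (3 : ℝ) ≤ a := by exact_mod_cast ha
  set ω : ℝ := ((a : ℝ) - (b : ℝ) * √(d : ℝ)) / 2 with hω
  have hconj : ((a : ℝ) + (b : ℝ) * √(d : ℝ)) / 2 = a - ω := by rw [hω]; ring
  have hmul : ω * (a - ω) = 1 := by
    rw [hω]
    linear_combination hnorm / 4 - (b : ℝ) ^ 2 / 4 * hsq
  -- The larger root a − ω = ε is at least a/2 ≥ 3/2. With ω(a − ω) = 1 this places ω strictly
  -- between 0 and 1.
  have hbig : 3 / 2 ≤ a - ω := by
    rw [← hconj]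
    have : 0 ≤ (b : ℝ) * √(d : ℝ) := by positivity
    linarith
  have hω0 : 0 < ω := by
    by_contra h
    nlinarith
  have hω1 : ω < 1 := by nlinarith
  have hirr : Irrational ω := by
    have h1 := (Shintani.irrational_sqrt_of_not_isSquare hd).natCast_mul hb
    exact (h1.natCast_sub a).div_natCast two_ne_zero
  have hp : (x, y) ∈ Shintani.unitDomain := by
    rw [hxy]
    exact ⟨Shintani.fractOne_pos _, Shintani.fractOne_le_one _, Int.fract_nonneg _,
      Int.fract_lt_one _⟩
  rw [hconj, eq_inv_of_mul_eq_one_right hmul]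
  exact ⟨Shintani.tendsto_cyclicDilog_swap ha hω0 hω1 hmul hirr hp horbit,
    Shintani.tendsto_cyclicDilog ha hω0 hω1 hmul hirr hp horbit⟩
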